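/- Let $n\ge 1$. A real $n\times n$ matrix $A$ is called a dilation if every complex eigenvalue $\lambda$ of $A$ satisfies $|\lambda|>1$. A quasi-norm associated with a dilation $A$ is a Lebesgue measurable map $\rho:\mathbb R^n\to[0,\infty)$ such that $\rho(x)=0$ if and only if $x=0$; $\rho(Ax)=|\det A|\,\rho(x)$ for all $x\in\mathbb R^n$; and there is a constant $C>0$ with $\rho(x+y)\le C(\rho(x)+\rho(y))$ for all $x,y\in\mathbb R^n$. **Theorem.** Let $A_1,A_2$ be two dilations on $\mathbb R^n$, and let $\rho_1,\rho_2$ be any quasi-norms associated with $A_1$ and $A_2$, respectively. The following are equivalent: (i) $\rho_1$ and $\rho_2$ are equivalent up to a linear transformation, i.e. there are a constant $c>0$ and an invertible real $n\times n$ matrix $S$ such that $$\tfrac1c\,\rho_1(x)\le\rho_2(Sx)\le c\,\rho_1(x)\qquad\text{for all }x\in\mathbb R^n;$$ (ii) for all real $r>1$ and all integers $m\ge1$, $$\sum_{|\lambda|=r^{\varepsilon}}\dim\ker(A_1-\lambda I)^m=\sum_{|\lambda|=r}\dim\ker(A_2-\lambda I)^m,\qquad \varepsilon=\frac{\ln|\det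 A_1|}{\ln|\det A_2|}.$$ Here $A_1,A_2$ act on $\mathbb C^n$, dimensions are over $\mathbb C$, and each sum runs over the complex numbers $\lambda$ of the given modulus (only eigenvalues contribute, so it is a finite sum). -/

import Mathlib

open MeasureTheory

/-- The complexification of a real `n × n` matrix, as a linear map on `ℂⁿ`. -/
noncomputable def complexLin {n : ℕ} (A : Matrix (Fin n) (Fin n) ℝ) :
    Module.End ℂ (Fin n → ℂ) :=
  Matrix.toLin' (A.map (algebraMap ℝ ℂ))

/-- A real `n × n` matrix is an (anisotropic, expansive) dilation if all of its complex
eigenvalues have modulus `> 1`. -/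
def IsDilation {n : ℕ} (A : Matrix (Fin n) (Fin n) ℝ) : Prop :=
  ∀ z : ℂ, (complexLin A).HasEigenvalue z → 1 < ‖z‖

/-- A quasi-norm on `ℝⁿ`. -/
structure IsQuasiNorm {n : ℕ} (ρ : (Fin n → ℝ) → ℝ) : Prop where
  nonneg : ∀ x, 0 ≤ ρ x
  eq_zero_iff : ∀ x, ρ x = 0 ↔ x = 0
  quasi_triangle : ∃ c : ℝ, 0 < c ∧ ∀ x y, ρ (x + y) ≤ c * (ρ x + ρ y)

/-- A (homogeneous) quasi-norm associated with the matrix `A`: a Lebesgue measurable quasi-norm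
with `ρ (A x) = |det A| ρ x`. -/
structure IsAssociatedQuasiNorm {n : ℕ} (A : Matrix (Fin n) (Fin n) ℝ)
    (ρ : (Fin n → ℝ) → ℝ) : Prop extends IsQuasiNorm ρ where
  measurable : NullMeasurable ρ (volume : Measure (Fin n → ℝ))
  homogeneous : ∀ x, ρ (A.mulVec x) = |A.det| * ρ x

/-- Equivalence of two functions (quasi-norms) on `ℝⁿ` up to an invertible linear
transformation. -/
def EquivalentUpToLinear {n : ℕ} (ρ₁ ρ₂ : (Fin n → ℝ) → ℝ) : Prop :=
  ∃ c : ℝ, 0 < c ∧ ∃ S : Matrix (Fin n) (Fin n) ℝ, IsUnit S ∧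
    ∀ x, 1 / c * ρ₁ x ≤ ρ₂ (S.mulVec x) ∧ ρ₂ (S.mulVec x) ≤ c * ρ₁ x

/-- The complex dimension of `ker (A - z I)^m`. -/
noncomputable def kerDim {n : ℕ} (A : Matrix (Fin n) (Fin n) ℝ) (z : ℂ) (m : ℕ) : ℕ :=
  Module.finrank ℂ (LinearMap.ker ((complexLin A - z • (1 : Module.End ℂ (Fin n → ℂ))) ^ m))

/-- The sum of `dim ker (A - z I)^m` over all complex `z` with `|z| = s`. Only eigenvalues
contribute, so the sum has finitely many nonzero terms (see `kerDim_support_finite`). -/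
noncomputable def sumKerDim {n : ℕ} (A : Matrix (Fin n) (Fin n) ℝ) (s : ℝ) (m : ℕ) : ℕ :=
  ∑ᶠ (z : ℂ) (_ : ‖z‖ = s), kerDim A z m

/-- The sum defining `sumKerDim` is a genuine finite sum. -/
theorem kerDim_support_finite {n : ℕ} (A : Matrix (Fin n) (Fin n) ℝ) (m : ℕ) :
    {z : ℂ | kerDim A z m ≠ 0}.Finite := by
  refine (Module.End.finite_hasEigenvalue (complexLin A)).subset ?_
  intro z hz
  by_contra hne
  apply hz
  have h1 : LinearMap.ker (complexLin A - z • (1 : Module.End ℂ (Fin n → ℂ))) = ⊥ := by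
    by_contra h
    apply hne
    rw [Set.mem_ofPred_eq, Module.End.hasEigenvalue_iff, Module.End.eigenspace_def]
    simpa [Algebra.algebraMap_eq_smul_one] using h
  have h2 : LinearMap.ker ((complexLin A - z • (1 : Module.End ℂ (Fin n → ℂ))) ^ m) = ⊥ := by
    rw [LinearMap.ker_eq_bot] at h1 ⊢
    rw [Module.End.coe_pow]
    exact h1.iterate m
  unfold kerDim
  rw [h2, finrank_bot]

/-!
The growth of the two-sided orbits `k ↦ A ^ k x`, `k ∈ ℤ`, is the link between a quasi-norm
associated with a dilation `A` and the Jordan structure of `A`.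

**Quasi-norms and orbits.** A measurable quasi-norm `ρ` associated with a dilation is bounded on
bounded sets (Steinhaus), hence continuous at the origin, hence bounded below on annuli, so that its
sublevel sets are bounded (`IsAssociatedQuasiNorm.exists_bound_of_norm_le`,
`IsAssociatedQuasiNorm.exists_norm_le_of_le`). Since `ρ (A ^ k x) = |det A| ^ k ρ x`, an inequality
`ρ₂ (S x) ≤ c ρ₁ x` amounts to `‖A₂ ^ k S x‖ ≤ C ‖A₁ ^ ⌊k τ⌋ x‖` for all `k ∈ ℤ` and all `x`, where
`|det A₁| ^ τ = |det A₂|` (`OrbitDominated.of_quasiNorm_le`, `OrbitDominated.quasiNorm_le`).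
Equivalence of `ρ₁` and `ρ₂` up to `S` is this statement for `S` and for `S⁻¹`.

**Orbits determine the Jordan data.** In `ℂⁿ` the vectors whose orbit is `O(r ^ k (1 + |k|) ^ d)`
for all `k ∈ ℤ` form the sum of the spaces `ker (A - λ) ^ (d + 1)` with `|λ| = r`, whose dimension
is `sumKerDim A r (d + 1)` (`finrank_growthSubmodule`). Domination of orbits lets `S` embed such a
space for `A₁` into the corresponding one for `A₂` (`OrbitDominated.sumKerDim_le`), and applying this
in both directions gives the equality of the dimensions.

**The Jordan data determine the orbits up to similarity.** On the generalized eigenspace of `λ`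
the operator `λ⁻¹ A` is unipotent, so it has real powers given by the binomial series. The operators
`|λ| ^ t (λ⁻¹ A) ^ t` assemble to a one-parameter group, which is real because it commutes with
complex conjugation (`modulusPow`). At integer times it differs from `A ^ k` only by powers of a
diagonalizable operator with unimodular eigenvalues, and is therefore comparable to it
(`exists_norm_zpow_le_modulusPow`). Its eigenvalue `c` at time `t` collects all `λ` with
`|λ| ^ t = c` (`finrank_ker_modulusPow`). The hypothesis on the kernels thus says that
`modulusPow A₁ 1` and `modulusPow A₂ ε` have the same Jordan blocks. Both have real eigenvalues, so
they are similar over `ℝ` by the structure theorem for `ℝ[X]`-modules (`exists_linearEquiv_conj`),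
and the similarity dominates orbits in both directions, as the group of `A₂` is bounded on compact
sets of times.
-/

open Module Polynomial

/-! ### Operators given by local polynomials on generalized eigenspaces -/

variable {K V : Type*} [Field K] [AddCommGroup V] [Module K V]

theorem finrank_biSup_of_iSupIndep [FiniteDimensional K V] {ι : Type*} (p : ι → Submodule K V)
    (hp : iSupIndep p) (s : Finset ι) :
    finrank K (⨆ i ∈ s, p i : Submodule K V) = ∑ i ∈ s, finrank K (p i) := by
  classical
  induction s using Finset.induction_on with
  | empty => simp
  | insert a s ha ih =>
    rw [Finset.iSup_insert, Finset.sum_insert ha, ← ih]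
    have hd : Disjoint (p a) (⨆ i ∈ s, p i) := by
      refine (hp a).mono_right (iSup₂_le fun i hi => ?_)
      exact le_iSup₂_of_le i (fun h => ha (h ▸ hi)) le_rfl
    have := Submodule.finrank_sup_add_finrank_inf_eq (p a) (⨆ i ∈ s, p i)
    rw [hd.eq_bot, finrank_bot, add_zero] at this
    exact this

theorem finite_setOf_maxGenEigenspace_ne_bot [FiniteDimensional K V] (f : End K V) :
    {μ : K | f.maxGenEigenspace μ ≠ ⊥}.Finite :=
  WellFoundedGT.finite_ne_bot_of_iSupIndep f.independent_maxGenEigenspace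

/-- An `f`-invariant subspace splits along the generalized eigenspaces of `f`. -/
theorem finrank_eq_finsum_inf_maxGenEigenspace [FiniteDimensional K V] [IsAlgClosed K]
    (f : End K V) (W : Submodule K V) (hW : ∀ x ∈ W, f x ∈ W) :
    finrank K W = ∑ᶠ μ : K, finrank K (W ⊓ f.maxGenEigenspace μ : Submodule K V) := by
  classical
  have hfin := finite_setOf_maxGenEigenspace_ne_bot f
  have hbot : ∀ μ, μ ∉ hfin.toFinset → W ⊓ f.maxGenEigenspace μ = ⊥ := by
    intro μ hμ
    have : f.maxGenEigenspace μ = ⊥ := by simpa using hμ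
    simp [this]
  rw [finsum_eq_sum_of_support_subset (s := hfin.toFinset), ← finrank_biSup_of_iSupIndep]
  · have h1 := Submodule.eq_iSup_inf_genEigenspace (p := W) ⊤ hW
      (Module.End.iSup_maxGenEigenspace_eq_top f)
    have h2 : W = ⨆ μ ∈ hfin.toFinset, W ⊓ f.maxGenEigenspace μ := by
      conv_lhs => rw [h1]
      refine le_antisymm (iSup_le fun μ => ?_) (iSup₂_le fun μ _ => le_iSup_of_le μ le_rfl)
      by_cases hμ : μ ∈ hfin.toFinset
      · exact le_iSup₂_of_le μ hμ le_rfl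
      · exact (hbot μ hμ).le.trans bot_le
    exact congrArg (fun W : Submodule K V => finrank K W) h2
  · exact f.independent_maxGenEigenspace.mono fun μ => inf_le_right
  · intro μ hμ
    by_contra h
    apply hμ
    show finrank K (W ⊓ f.maxGenEigenspace μ : Submodule K V) = 0
    rw [hbot μ h, finrank_bot]

theorem exists_pow_sub_smul_apply_eq_zero {f : End K V} {μ : K} {x : V}
    (hx : x ∈ f.maxGenEigenspace μ) : ∃ k : ℕ, ((f - μ • (1 : End K V)) ^ k) x = 0 := by
  simpa [Module.End.mem_maxGenEigenspace] using hx

theorem ker_pow_le_maxGenEigenspace (f : End K V) (μ : K) (m : ℕ) :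
    LinearMap.ker ((f - μ • (1 : End K V)) ^ m) ≤ f.maxGenEigenspace μ := by
  intro x hx
  rw [Module.End.mem_maxGenEigenspace]
  exact ⟨m, hx⟩

/-- The dimension of an `f`-invariant subspace that meets the generalized eigenspace of `μ` in
`ker (f - μ)^m` for the eigenvalues `μ` satisfying `P`, and trivially for the others. -/
theorem finrank_eq_finsum_finrank_ker_pow [FiniteDimensional K V] [IsAlgClosed K]
    (f : End K V) (W : Submodule K V) (hW : ∀ x ∈ W, f x ∈ W) (P : K → Prop) (m : ℕ)
    (hP : ∀ μ, P μ → ∀ x ∈ f.maxGenEigenspace μ, x ∈ W ↔ ((f - μ • (1 : End K V)) ^ m) x = 0)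
    (hP' : ∀ μ, ¬ P μ → ∀ x ∈ f.maxGenEigenspace μ, x ∈ W → x = 0) :
    finrank K W = ∑ᶠ (μ : K) (_ : P μ),
      finrank K (LinearMap.ker ((f - μ • (1 : End K V)) ^ m)) := by
  classical
  rw [finrank_eq_finsum_inf_maxGenEigenspace f _ hW]
  refine finsum_congr fun μ => ?_
  rw [finsum_eq_if]
  split_ifs with hμ
  · have : W ⊓ f.maxGenEigenspace μ = LinearMap.ker ((f - μ • (1 : End K V)) ^ m) := by
      ext x
      rw [Submodule.mem_inf, LinearMap.mem_ker]
      constructor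
      · rintro ⟨h1, hx⟩
        exact (hP μ hμ x hx).1 h1
      · intro h1
        have hx := ker_pow_le_maxGenEigenspace f μ m h1
        exact ⟨(hP μ hμ x hx).2 h1, hx⟩
    rw [this]
  · have : W ⊓ f.maxGenEigenspace μ = ⊥ := by
      rw [eq_bot_iff]
      rintro x ⟨h1, hx⟩
      exact hP' μ hμ x hx h1
    rw [this, finrank_bot]

theorem aeval_X_sub_C_pow (f : End K V) (μ : K) (k : ℕ) :
    aeval f ((X - C μ) ^ k) = (f - μ • (1 : End K V)) ^ k := by
  simp [Algebra.algebraMap_eq_smul_one]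

theorem aeval_mem_maxGenEigenspace {f : End K V} {μ : K} {x : V}
    (hx : x ∈ f.maxGenEigenspace μ) (p : K[X]) : aeval f p x ∈ f.maxGenEigenspace μ :=
  f.mapsTo_maxGenEigenspace_of_comm (by
    have := (Commute.all X p).map (aeval f)
    rwa [aeval_X] at this) μ hx

/-- On the generalized eigenspace of `μ` an operator `p(f)` with `p(μ) ≠ 0` is injective. -/
theorem eq_zero_of_aeval_eq_zero {f : End K V} {μ : K} {x : V}
    (hx : x ∈ f.maxGenEigenspace μ) {p : K[X]} (hp : p.eval μ ≠ 0) (h : aeval f p x = 0) :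
    x = 0 := by
  obtain ⟨k, hk⟩ := exists_pow_sub_smul_apply_eq_zero hx
  have hcop : IsCoprime p ((X - C μ) ^ k) := by
    refine IsCoprime.pow_right ?_
    refine ((irreducible_X_sub_C μ).coprime_iff_not_dvd.2 ?_).symm
    rwa [dvd_iff_isRoot]
  obtain ⟨a, b, hab⟩ := hcop
  have := congrArg (fun q => aeval f q x) hab
  simp only [map_add, map_mul, LinearMap.add_apply, Module.End.mul_apply, h, map_zero, zero_add,
    map_one, Module.End.one_apply, aeval_X_sub_C_pow, hk] at this
  exact this.symm

/-- `F` is obtained from `f` by applying, on each generalized eigenspace of `f`, the polynomial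
attached to the corresponding eigenvalue: `F = (g μ)(f)` on the generalized eigenspace of `μ`. -/
def IsLocalPolynomial (f : End K V) (g : K → K[X]) (F : End K V) : Prop :=
  ∀ μ : K, ∀ x ∈ f.maxGenEigenspace μ, F x = aeval f (g μ) x

namespace IsLocalPolynomial

variable {f F G : End K V} {g h : K → K[X]}

/-- An operator is determined by its action on the generalized eigenspaces. -/
theorem unique [FiniteDimensional K V] [IsAlgClosed K] (hF : IsLocalPolynomial f g F)
    (hG : IsLocalPolynomial f h G)
    (hgh : ∀ μ, ∀ x ∈ f.maxGenEigenspace μ, aeval f (g μ) x = aeval f (h μ) x) : F = G := by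
  rw [← LinearMap.eqLocus_eq_top, eq_top_iff, ← Module.End.iSup_maxGenEigenspace_eq_top f]
  refine iSup_le fun μ x hx => ?_
  rw [LinearMap.mem_eqLocus, hF μ x hx, hG μ x hx, hgh μ x hx]

theorem mul (hF : IsLocalPolynomial f g F) (hG : IsLocalPolynomial f h G) :
    IsLocalPolynomial f (fun μ => g μ * h μ) (F * G) := by
  intro μ x hx
  rw [Module.End.mul_apply, hG μ x hx, hF μ _ (aeval_mem_maxGenEigenspace hx _), map_mul,
    Module.End.mul_apply]

theorem pow (hF : IsLocalPolynomial f g F) (m : ℕ) :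
    IsLocalPolynomial f (fun μ => g μ ^ m) (F ^ m) := by
  induction m with
  | zero => intro μ x _; simp
  | succ m ih => simpa only [pow_succ] using ih.mul hF

theorem sub_smul_one (hF : IsLocalPolynomial f g F) (c : K) :
    IsLocalPolynomial f (fun μ => g μ - C c) (F - c • (1 : End K V)) := by
  intro μ x hx
  simp [hF μ x hx, Algebra.algebraMap_eq_smul_one]

theorem aeval_const (f : End K V) (p : K[X]) : IsLocalPolynomial f (fun _ => p) (aeval f p) :=
  fun _ _ _ => rfl

theorem commute [FiniteDimensional K V] [IsAlgClosed K] (hF : IsLocalPolynomial f g F) :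
    Commute f F := by
  have hf : IsLocalPolynomial f (fun _ => X) f := by
    simpa using aeval_const f (X : K[X])
  exact (hf.mul hF).unique (hF.mul hf) fun μ x _ => by rw [mul_comm]

/-- Arbitrary polynomials can be prescribed on the generalized eigenspaces, because `V` is their direct
sum. -/
theorem _root_.exists_isLocalPolynomial [FiniteDimensional K V] [IsAlgClosed K] (f : End K V) (g : K → K[X]) :
    ∃ F : End K V, IsLocalPolynomial f g F := by
  classical
  have hint : DirectSum.IsInternal f.maxGenEigenspace := by
    rw [DirectSum.isInternal_submodule_iff_iSupIndep_and_iSup_eq_top]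
    exact ⟨f.independent_maxGenEigenspace, Module.End.iSup_maxGenEigenspace_eq_top f⟩
  let e := LinearEquiv.ofBijective (DirectSum.coeLinearMap f.maxGenEigenspace) hint
  refine ⟨(DirectSum.toModule K K V fun μ => (aeval f (g μ)).comp
    (f.maxGenEigenspace μ).subtype).comp e.symm.toLinearMap, fun μ x hx => ?_⟩
  have : e.symm x = DirectSum.lof K K (fun μ => f.maxGenEigenspace μ) μ ⟨x, hx⟩ := by
    rw [LinearEquiv.symm_apply_eq]
    exact (DirectSum.coeLinearMap_lof f.maxGenEigenspace μ ⟨x, hx⟩).symm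
  simp [this]

/-- If `F` acts as `g μ (f)` on the generalized eigenspace of `μ`, and `g μ` is a local coordinate
at each eigenvalue `μ`, then the Jordan structure of `F` at `c` collects that of `f` at all
eigenvalues `μ` with `g μ (μ) = c`. -/
theorem finrank_ker_pow [FiniteDimensional K V] [IsAlgClosed K] (hF : IsLocalPolynomial f g F)
    (hg : ∀ μ, f.maxGenEigenspace μ ≠ ⊥ → (derivative (g μ)).eval μ ≠ 0) (c : K) (m : ℕ) :
    finrank K (LinearMap.ker ((F - c • (1 : End K V)) ^ m)) =
      ∑ᶠ (μ : K) (_ : (g μ).eval μ = c),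
        finrank K (LinearMap.ker ((f - μ • (1 : End K V)) ^ m)) := by
  have hP := (hF.sub_smul_one c).pow m
  have hW : ∀ x ∈ LinearMap.ker ((F - c • (1 : End K V)) ^ m),
      f x ∈ LinearMap.ker ((F - c • (1 : End K V)) ^ m) := by
    intro x hx
    have := congrArg (fun T : End K V => T x) hP.commute.eq
    simp only [Module.End.mul_apply] at this
    rw [LinearMap.mem_ker] at hx ⊢
    rw [← this, hx, map_zero]
  refine finrank_eq_finsum_finrank_ker_pow f _ hW _ m (fun μ hc x hx => ?_) fun μ hc x hx h1 => ?_
  · rw [LinearMap.mem_ker]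
    by_cases hbot : f.maxGenEigenspace μ = ⊥
    · rw [hbot, Submodule.mem_bot] at hx
      simp [hx]
    obtain ⟨q, hq⟩ : X - C μ ∣ g μ - C c := by
      rw [dvd_iff_isRoot, IsRoot.def, eval_sub, eval_C, hc, sub_self]
    have hq0 : q.eval μ ≠ 0 := by
      have := hg μ hbot
      have h2 : derivative (g μ) = derivative (g μ - C c) := by simp
      rw [h2, hq] at this
      simpa using this
    have key : ((F - c • (1 : End K V)) ^ m) x =
        aeval f (q ^ m) (((f - μ • (1 : End K V)) ^ m) x) := by
      have := hP μ x hx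
      simp only [hq] at this
      rw [this, mul_pow, mul_comm, map_mul, Module.End.mul_apply, aeval_X_sub_C_pow]
    rw [key]
    constructor
    · refine eq_zero_of_aeval_eq_zero (μ := μ) ?_ (by simpa using pow_ne_zero m hq0)
      rw [← aeval_X_sub_C_pow]
      exact aeval_mem_maxGenEigenspace hx _
    · intro h1
      rw [h1, map_zero]
  · rw [LinearMap.mem_ker, hP μ x hx] at h1
    refine eq_zero_of_aeval_eq_zero hx ?_ h1
    simpa using pow_ne_zero m (sub_ne_zero.2 hc)

end IsLocalPolynomial

/-! ### Real powers of unipotent parts -/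

theorem succ_mul_choose_succ (t : ℝ) (n : ℕ) :
    ((n : ℝ) + 1) * Ring.choose t (n + 1) = Ring.choose t n * (t - n) := by
  have := Ring.choose_smul_choose t (Nat.le_succ n)
  rw [Nat.succ_eq_add_one, Nat.add_sub_cancel_left, Ring.choose_one_right,
    Nat.choose_succ_self_right, nsmul_eq_mul] at this
  exact_mod_cast this

theorem abs_choose_le (t : ℝ) (n : ℕ) : |Ring.choose t n| ≤ (1 + |t|) ^ n := by
  induction n with
  | zero => simp
  | succ n ih =>
    have h1 := congrArg abs (succ_mul_choose_succ t n)
    rw [abs_mul, abs_mul, abs_of_pos (by positivity : (0 : ℝ) < (n : ℝ) + 1)] at h1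
    have h2 : |t - n| ≤ ((n : ℝ) + 1) * (1 + |t|) := by
      have := abs_sub t (n : ℝ)
      rw [Nat.abs_cast] at this
      nlinarith [abs_nonneg t, (n.cast_nonneg : (0 : ℝ) ≤ n)]
    have h3 : ((n : ℝ) + 1) * |Ring.choose t (n + 1)| ≤
        ((n : ℝ) + 1) * (1 + |t|) ^ (n + 1) := by
      rw [h1]
      calc |Ring.choose t n| * |t - n| ≤ (1 + |t|) ^ n * (((n : ℝ) + 1) * (1 + |t|)) := by gcongr
        _ = _ := by ring
    exact le_of_mul_le_mul_left h3 (by positivity)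

/-- The binomial series `(1 + Y)^t` truncated at degree `d`, evaluated at `Y = μ⁻¹ X - 1`. On
vectors killed by `(f - μ)^d` it represents the power `(μ⁻¹ f)^t` with real exponent `t`. -/
noncomputable def unipotentPow (d : ℕ) (μ : ℂ) (t : ℝ) : ℂ[X] :=
  ((PowerSeries.binomialSeries ℂ t).trunc d).comp (C μ⁻¹ * X - 1)

theorem unipotentPow_eq_sum (d : ℕ) (μ : ℂ) (t : ℝ) :
    unipotentPow d μ t =
      ∑ i ∈ Finset.range d, C ((Ring.choose t i : ℝ) : ℂ) * (C μ⁻¹ * X - 1) ^ i := by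
  rw [unipotentPow, PowerSeries.trunc_apply, ← Finset.range_eq_Ico, comp, eval₂_finsetSum]
  refine Finset.sum_congr rfl fun i _ => ?_
  simp [← C_mul_X_pow_eq_monomial]

theorem C_inv_mul_X_sub_one {μ : ℂ} (hμ : μ ≠ 0) : C μ⁻¹ * X - 1 = C μ⁻¹ * (X - C μ) := by
  rw [mul_sub, ← C_mul, inv_mul_cancel₀ hμ, C_1]

theorem unipotentPow_one (d : ℕ) (hd : 2 ≤ d) (μ : ℂ) : unipotentPow d μ 1 = C μ⁻¹ * X := by
  obtain ⟨d, rfl⟩ := Nat.exists_eq_add_of_le' hd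
  have h := PowerSeries.binomialSeries_nat (R := ℝ) (A := ℂ) 1
  rw [Nat.cast_one, pow_one] at h
  rw [unipotentPow, h, map_add, PowerSeries.trunc_one, PowerSeries.trunc_X]
  simp

theorem unipotentPow_zero (d : ℕ) (hd : 1 ≤ d) (μ : ℂ) : unipotentPow d μ 0 = 1 := by
  obtain ⟨d, rfl⟩ := Nat.exists_eq_add_of_le' hd
  rw [unipotentPow, PowerSeries.binomialSeries_zero, PowerSeries.trunc_one]
  simp

section

variable {V : Type*} [AddCommGroup V] [Module ℂ V]

theorem aeval_inv_mul_X_sub_one_pow (f : End ℂ V) {μ : ℂ} (hμ : μ ≠ 0) (i : ℕ) :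
    aeval f ((C μ⁻¹ * X - 1 : ℂ[X]) ^ i) = (μ⁻¹) ^ i • (f - μ • (1 : End ℂ V)) ^ i := by
  rw [C_inv_mul_X_sub_one hμ, mul_pow, map_mul, aeval_X_sub_C_pow, ← C_pow, aeval_C,
    Algebra.algebraMap_eq_smul_one, smul_mul_assoc, one_mul]

theorem aeval_unipotentPow (f : End ℂ V) (d : ℕ) {μ : ℂ} (hμ : μ ≠ 0) (t : ℝ) (x : V) :
    aeval f (unipotentPow d μ t) x =
      ∑ i ∈ Finset.range d, ((Ring.choose t i : ℝ) : ℂ) • (μ⁻¹) ^ i •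
        ((f - μ • (1 : End ℂ V)) ^ i) x := by
  rw [unipotentPow_eq_sum, map_sum, LinearMap.sum_apply]
  refine Finset.sum_congr rfl fun i _ => ?_
  rw [map_mul, aeval_C, aeval_inv_mul_X_sub_one_pow f hμ, Module.algebraMap_end_eq_smul_id]
  rfl

theorem aeval_unipotentPow_of_le (f : End ℂ V) {m d : ℕ} (hmd : m ≤ d) {μ : ℂ} (hμ : μ ≠ 0)
    (t : ℝ) {x : V} (hx : ((f - μ • (1 : End ℂ V)) ^ m) x = 0) :
    aeval f (unipotentPow d μ t) x = aeval f (unipotentPow m μ t) x := by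
  rw [aeval_unipotentPow f d hμ, aeval_unipotentPow f m hμ]
  refine (Finset.sum_subset (Finset.range_mono hmd) fun i _ hi => ?_).symm
  obtain ⟨j, rfl⟩ := Nat.exists_eq_add_of_le' (not_lt.1 (fun h => hi (Finset.mem_range.2 h)))
  rw [pow_add (f - _), Module.End.mul_apply, hx, map_zero, smul_zero, smul_zero]

/-- Exponent addition for `unipotentPow`, from the Chu–Vandermonde identity for the binomial series. -/
theorem aeval_unipotentPow_mul (f : End ℂ V) (d : ℕ) {μ : ℂ} (hμ : μ ≠ 0) (s t : ℝ) {x : V}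
    (hx : ((f - μ • (1 : End ℂ V)) ^ d) x = 0) :
    aeval f (unipotentPow d μ s * unipotentPow d μ t) x = aeval f (unipotentPow d μ (s + t)) x := by
  set a := PowerSeries.binomialSeries ℂ s
  set b := PowerSeries.binomialSeries ℂ t
  -- The two truncated products agree modulo `X ^ d`.
  obtain ⟨q, hq⟩ : X ^ d ∣ a.trunc d * b.trunc d - (a * b).trunc d := by
    rw [X_pow_dvd_iff]
    intro i hi
    have h := congrArg (fun p => p.coeff i) (PowerSeries.trunc_trunc_mul_trunc (n := d) a b)
    simp only [PowerSeries.coeff_trunc, if_pos hi] at h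
    rw [coeff_sub, PowerSeries.coeff_trunc, if_pos hi, ← h, ← Polynomial.coe_mul,
      Polynomial.coeff_coe, sub_self]
  have key : unipotentPow d μ s * unipotentPow d μ t - unipotentPow d μ (s + t) =
      q.comp (C μ⁻¹ * X - 1) * (C μ⁻¹ * X - 1) ^ d := by
    rw [unipotentPow, unipotentPow, unipotentPow, PowerSeries.binomialSeries_add, ← mul_comp,
      ← sub_comp, hq, mul_comm, mul_comp, X_pow_comp]
  rw [← sub_eq_zero, ← LinearMap.sub_apply, ← map_sub, key, map_mul, Module.End.mul_apply,
    aeval_inv_mul_X_sub_one_pow f hμ, LinearMap.smul_apply, hx, smul_zero, map_zero]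

/-- A homomorphism from `ℤ` to a monoid consists of the integer powers of its value at `1`. -/
theorem eq_zpow_of_add {M : Type*} [Monoid M] (E : ℤ → M) (u : Mˣ)
    (h0 : E 0 = 1) (h1 : E 1 = u) (hadd : ∀ j k, E (j + k) = E j * E k) (k : ℤ) :
    E k = ↑(u ^ k) := by
  induction k using Int.induction_on with
  | zero => simpa using h0
  | succ k ih => rw [hadd, ih, h1, zpow_add_one, Units.val_mul]
  | pred k ih =>
    have : E (-(k : ℤ) - 1) * u = E (-(k : ℤ)) := by rw [← h1, ← hadd, sub_add_cancel]
    rw [zpow_sub_one, Units.val_mul, ← ih, ← this, Units.mul_inv_cancel_right]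

theorem maxGenEigenspace_zero_units (u : (End ℂ V)ˣ) :
    (u : End ℂ V).maxGenEigenspace 0 = ⊥ := by
  rw [eq_bot_iff]
  intro x hx
  obtain ⟨k, hk⟩ := exists_pow_sub_smul_apply_eq_zero hx
  rw [zero_smul, sub_zero, ← Units.val_pow_eq_pow_val] at hk
  have : (((u ^ k)⁻¹ : (End ℂ V)ˣ) : End ℂ V) (((u ^ k : (End ℂ V)ˣ) : End ℂ V) x) = x := by
    rw [← Module.End.mul_apply, Units.inv_mul, Module.End.one_apply]
  rw [← this, hk, map_zero]
  exact Submodule.zero_mem _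

theorem ne_zero_of_maxGenEigenspace_ne_bot {u : (End ℂ V)ˣ} {μ : ℂ}
    (hμ : (u : End ℂ V).maxGenEigenspace μ ≠ ⊥) : μ ≠ 0 := by
  rintro rfl
  exact hμ (maxGenEigenspace_zero_units u)

variable [FiniteDimensional ℂ V]

theorem pow_finrank_add_apply_eq_zero {f : End ℂ V} {μ : ℂ} {x : V}
    (hx : x ∈ f.maxGenEigenspace μ) (j : ℕ) :
    ((f - μ • (1 : End ℂ V)) ^ (finrank ℂ V + j)) x = 0 := by
  rw [Module.End.maxGenEigenspace_eq_genEigenspace_finrank, Module.End.mem_genEigenspace_nat,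
    LinearMap.mem_ker] at hx
  rw [add_comm, pow_add, Module.End.mul_apply, hx, map_zero]

/-- The operator acting on the generalized eigenspace of `μ` as `χ μ • (μ⁻¹ f)^t`, where the power
of the unipotent operator `μ⁻¹ f` is given by the binomial series. -/
noncomputable def twistedPow (f : End ℂ V) (χ : ℂ → ℂ) (t : ℝ) : End ℂ V :=
  (exists_isLocalPolynomial f
    (fun μ => C (χ μ) * unipotentPow (finrank ℂ V + 2) μ t)).choose

theorem isLocalPolynomial_twistedPow (f : End ℂ V) (χ : ℂ → ℂ) (t : ℝ) :
    IsLocalPolynomial f (fun μ => C (χ μ) * unipotentPow (finrank ℂ V + 2) μ t)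
      (twistedPow f χ t) :=
  (exists_isLocalPolynomial f
    (fun μ => C (χ μ) * unipotentPow (finrank ℂ V + 2) μ t)).choose_spec

theorem twistedPow_congr {f : End ℂ V} {χ χ' : ℂ → ℂ}
    (h : ∀ μ, f.maxGenEigenspace μ ≠ ⊥ → χ μ = χ' μ) (t : ℝ) :
    twistedPow f χ t = twistedPow f χ' t := by
  refine (isLocalPolynomial_twistedPow f χ t).unique (isLocalPolynomial_twistedPow f χ' t)
    fun μ x hx => ?_
  by_cases hμ : f.maxGenEigenspace μ = ⊥
  · rw [hμ, Submodule.mem_bot] at hx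
    simp [hx]
  · simp only [h μ hμ]

theorem twistedPow_mul {f : End ℂ V} (hf : f.maxGenEigenspace 0 = ⊥) (χ χ' : ℂ → ℂ) (s t : ℝ) :
    twistedPow f χ s * twistedPow f χ' t = twistedPow f (χ * χ') (s + t) := by
  refine ((isLocalPolynomial_twistedPow f χ s).mul (isLocalPolynomial_twistedPow f χ' t)).unique
    (isLocalPolynomial_twistedPow f _ _) fun μ x hx => ?_
  by_cases hμ : μ = 0
  · rw [hμ, hf, Submodule.mem_bot] at hx
    simp [hx]
  · rw [mul_mul_mul_comm, ← C_mul, Pi.mul_apply, map_mul (aeval _) (C _), Module.End.mul_apply,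
      map_mul (aeval _) (C _), Module.End.mul_apply, aeval_unipotentPow_mul f _ hμ _ _ (pow_finrank_add_apply_eq_zero hx 2)]

theorem twistedPow_one_zero (f : End ℂ V) : twistedPow f 1 0 = 1 := by
  refine (isLocalPolynomial_twistedPow f 1 0).unique (IsLocalPolynomial.aeval_const f 1 |>.mul
    (IsLocalPolynomial.aeval_const f 1)) (fun μ x hx => ?_) |>.trans (by simp)
  rw [unipotentPow_zero _ (by omega)]
  simp

theorem twistedPow_id_one {f : End ℂ V} (hf : f.maxGenEigenspace 0 = ⊥) :
    twistedPow f id 1 = f := by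
  refine (isLocalPolynomial_twistedPow f id 1).unique (IsLocalPolynomial.aeval_const f X)
    (fun μ x hx => ?_) |>.trans (by simp)
  by_cases hμ : μ = 0
  · rw [hμ, hf, Submodule.mem_bot] at hx
    simp [hx]
  · rw [unipotentPow_one _ (by omega), ← mul_assoc, ← C_mul, id, mul_inv_cancel₀ hμ, C_1, one_mul]

theorem twistedPow_zpow (u : (End ℂ V)ˣ) (k : ℤ) :
    twistedPow (u : End ℂ V) (fun μ => μ ^ k) k = ↑(u ^ k) := by
  have hu := maxGenEigenspace_zero_units u
  refine eq_zpow_of_add (fun k : ℤ => twistedPow (u : End ℂ V) (fun μ => μ ^ k) k) u ?_ ?_ ?_ k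
  · simp only [zpow_zero, Int.cast_zero]
    exact twistedPow_one_zero _
  · simp only [zpow_one, Int.cast_one]
    exact twistedPow_id_one hu
  · intro j k
    simp only [twistedPow_mul hu, Int.cast_add]
    refine twistedPow_congr (fun μ hμ => ?_) _
    exact zpow_add₀ (ne_zero_of_maxGenEigenspace_ne_bot hμ) _ _

/-- The binomial expansion of `u ^ k = μ ^ k (1 + μ⁻¹ (u - μ)) ^ k` on a generalized eigenvector, for
exponents `k` of either sign. -/
theorem zpow_apply_eq_sum (u : (End ℂ V)ˣ) {μ : ℂ} (hμ : μ ≠ 0) {m : ℕ} {x : V}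
    (hx : (((u : End ℂ V) - μ • (1 : End ℂ V)) ^ m) x = 0) (k : ℤ) :
    ((u ^ k : (End ℂ V)ˣ) : End ℂ V) x = μ ^ k • ∑ i ∈ Finset.range m,
      ((Ring.choose (k : ℝ) i : ℝ) : ℂ) • (μ⁻¹) ^ i •
        (((u : End ℂ V) - μ • (1 : End ℂ V)) ^ i) x := by
  have hx' : x ∈ (u : End ℂ V).maxGenEigenspace μ := ker_pow_le_maxGenEigenspace _ _ m hx
  rw [← aeval_unipotentPow _ m hμ, ← twistedPow_zpow, isLocalPolynomial_twistedPow _ _ _ μ x hx',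
    map_mul, aeval_C, Module.End.mul_apply, Module.algebraMap_end_apply]
  congr 1
  rw [← aeval_unipotentPow_of_le _ (le_max_left m (finrank ℂ V + 2)) hμ _ hx,
    ← aeval_unipotentPow_of_le _ (le_max_right m (finrank ℂ V + 2)) hμ _
      (pow_finrank_add_apply_eq_zero hx' 2)]

end

section

variable {V : Type*} [NormedAddCommGroup V] [NormedSpace ℂ V] [FiniteDimensional ℂ V]

theorem exists_norm_apply_le (T : End ℂ V) : ∃ C : ℝ, 0 ≤ C ∧ ∀ x, ‖T x‖ ≤ C * ‖x‖ :=
  ⟨‖LinearMap.toContinuousLinearMap T‖, norm_nonneg _,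
    fun x => (LinearMap.toContinuousLinearMap T).le_opNorm x⟩

/-- Expansion of `twistedPow` in terms of the spectral projections `P μ` of `f`. -/
theorem twistedPow_eq_sum {f : End ℂ V} {s : Finset ℂ}
    (hs : ∀ μ, f.maxGenEigenspace μ ≠ ⊥ → μ ∈ s) {P : ℂ → End ℂ V}
    (hP : ∀ μ, IsLocalPolynomial f (Pi.single μ 1) (P μ)) (χ : ℂ → ℂ) (t : ℝ) :
    twistedPow f χ t = ∑ μ ∈ s, ∑ i ∈ Finset.range (finrank ℂ V + 2),
      (χ μ * ((Ring.choose t i : ℝ) : ℂ)) • (aeval f ((C μ⁻¹ * X - 1) ^ i) * P μ) := by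
  refine (isLocalPolynomial_twistedPow f χ t).unique (F := twistedPow f χ t)
    (h := fun μ => C (χ μ) * unipotentPow (finrank ℂ V + 2) μ t) (fun μ x hx => ?_)
    fun _ _ _ => rfl
  by_cases hμ : f.maxGenEigenspace μ = ⊥
  · rw [hμ, Submodule.mem_bot] at hx
    simp [hx]
  rw [LinearMap.sum_apply, Finset.sum_eq_single μ]
  · rw [LinearMap.sum_apply, map_mul, unipotentPow_eq_sum, map_sum, Finset.mul_sum,
      LinearMap.sum_apply]
    refine Finset.sum_congr rfl fun i _ => ?_
    rw [LinearMap.smul_apply, Module.End.mul_apply, hP μ μ x hx, Pi.single_eq_same, map_one,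
      Module.End.one_apply, map_mul, aeval_C, aeval_C, Module.End.mul_apply, Module.End.mul_apply,
      Module.algebraMap_end_apply, Module.algebraMap_end_apply, smul_smul]
  · intro ν _ hν
    rw [LinearMap.sum_apply]
    refine Finset.sum_eq_zero fun i _ => ?_
    rw [LinearMap.smul_apply, Module.End.mul_apply, hP ν μ x hx, Pi.single_eq_of_ne hν.symm]
    simp
  · exact fun h => absurd (hs μ hμ) h

/-- A bound for the operators `χ μ • (μ⁻¹ f)^t` that is uniform in the character `χ` and
polynomial in the exponent `t`. -/
theorem exists_norm_twistedPow_apply_le (f : End ℂ V) :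
    ∃ C : ℝ, 0 ≤ C ∧ ∀ (χ : ℂ → ℂ) (M t : ℝ), (∀ μ, f.maxGenEigenspace μ ≠ ⊥ → ‖χ μ‖ ≤ M) →
      ∀ x, ‖twistedPow f χ t x‖ ≤ C * M * (1 + |t|) ^ (finrank ℂ V + 2) * ‖x‖ := by
  choose P hP using fun μ : ℂ => exists_isLocalPolynomial f (Pi.single μ (1 : ℂ[X]))
  choose c hc0 hc using fun (μ : ℂ) (i : ℕ) =>
    exists_norm_apply_le (aeval f ((C μ⁻¹ * X - 1) ^ i) * P μ)
  have hfin := finite_setOf_maxGenEigenspace_ne_bot f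
  have hs : ∀ μ, μ ∈ hfin.toFinset ↔ f.maxGenEigenspace μ ≠ ⊥ := fun μ => by simp
  refine ⟨∑ μ ∈ hfin.toFinset, ∑ i ∈ Finset.range (finrank ℂ V + 2), c μ i,
    Finset.sum_nonneg fun μ _ => Finset.sum_nonneg fun i _ => hc0 μ i, fun χ M t hχ x => ?_⟩
  rw [twistedPow_eq_sum (fun μ hμ => (hs μ).2 hμ) hP, LinearMap.sum_apply, Finset.sum_mul,
    Finset.sum_mul, Finset.sum_mul]
  refine norm_sum_le_of_le _ fun μ hμ => ?_
  rw [LinearMap.sum_apply, Finset.sum_mul, Finset.sum_mul, Finset.sum_mul]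
  refine norm_sum_le_of_le _ fun i hi => ?_
  have hM := hχ μ ((hs μ).1 hμ)
  have hM0 : 0 ≤ M := (norm_nonneg _).trans hM
  rw [LinearMap.smul_apply, norm_smul, norm_mul, Complex.norm_real, Real.norm_eq_abs]
  have h1 : |Ring.choose t i| ≤ (1 + |t|) ^ (finrank ℂ V + 2) :=
    (abs_choose_le t i).trans (pow_le_pow_right₀ (by linarith [abs_nonneg t])
      (Finset.mem_range.1 hi).le)
  calc ‖χ μ‖ * |Ring.choose t i| * ‖(aeval f ((C μ⁻¹ * X - 1) ^ i) * P μ) x‖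
      ≤ M * (1 + |t|) ^ (finrank ℂ V + 2) * (c μ i * ‖x‖) := by
        gcongr
        exact hc μ i x
    _ = _ := by ring

end

/-! ### Orbit growth and the Jordan structure -/

/-- Exponential growth beats polynomial growth. -/
theorem le_one_of_pow_le_mul_pow {q C : ℝ} {d : ℕ} (h : ∀ n : ℕ, q ^ n ≤ C * (1 + n) ^ d) :
    q ≤ 1 := by
  by_contra! hq
  have h1 := (tendsto_pow_const_div_const_pow_of_one_lt d hq).comp (Filter.tendsto_add_atTop_nat 1)
  have h2 : Filter.Tendsto (fun n : ℕ => C * q * (((n + 1 : ℕ) : ℝ) ^ d / q ^ (n + 1)))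
      Filter.atTop (nhds (C * q * 0)) := h1.const_mul _
  rw [mul_zero] at h2
  obtain ⟨n, hn⟩ := (h2.eventually_lt_const one_pos).exists
  have h3 := h n
  have hq0 : (0 : ℝ) < q := by linarith
  rw [mul_div_assoc', div_lt_one (by positivity), pow_succ] at hn
  push_cast at hn
  rw [add_comm (n : ℝ) 1] at hn
  nlinarith

theorem eq_one_of_zpow_le_mul_pow {q C : ℝ} {d : ℕ} (hq : 0 < q)
    (h : ∀ k : ℤ, q ^ k ≤ C * (1 + |(k : ℝ)|) ^ d) : q = 1 := by
  refine le_antisymm (le_one_of_pow_le_mul_pow (C := C) (d := d) fun n => ?_) ?_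
  · simpa using h n
  · rw [← inv_le_one₀ hq]
    refine le_one_of_pow_le_mul_pow (C := C) (d := d) fun n => ?_
    simpa using h (-n)

/-- The binomial coefficients `n.choose (d + 1)` grow faster than `n ^ d`. -/
theorem not_forall_choose_le (C : ℝ) (d : ℕ) :
    ¬ ∀ n : ℕ, (n.choose (d + 1) : ℝ) ≤ C * (1 + n) ^ d := by
  intro h
  have hC : 0 ≤ C := by
    have := h 0
    simpa using this
  obtain ⟨N, hN⟩ := exists_nat_gt (((d + 1).factorial : ℝ) * (C * (d + 3 : ℝ) ^ d))
  have h1 := Nat.pow_le_choose (α := ℝ) (d + 1) (N + d + 1)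
  have h2 := h (N + d + 1)
  have h3 : N + d + 1 + 1 - (d + 1) = N + 1 := by omega
  rw [h3] at h1
  push_cast at h1 h2
  have hN0 : (0 : ℝ) ≤ N := N.cast_nonneg
  have hd0 : (0 : ℝ) ≤ d := d.cast_nonneg
  have h4 : (1 + ((N : ℝ) + d + 1)) ^ d ≤ ((d + 3 : ℝ) * (N + 1)) ^ d := by
    gcongr
    nlinarith
  have h5 : ((N : ℝ) + 1) ^ (d + 1) ≤
      ((d + 1).factorial : ℝ) * (C * (d + 3 : ℝ) ^ d) * ((N : ℝ) + 1) ^ d := by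
    calc ((N : ℝ) + 1) ^ (d + 1) ≤ ((d + 1).factorial : ℝ) * ((N + d + 1).choose (d + 1) : ℝ) := by
          rw [div_le_iff₀ (by positivity), mul_comm] at h1
          exact h1
      _ ≤ ((d + 1).factorial : ℝ) * (C * ((d + 3 : ℝ) * (N + 1)) ^ d) := by
          gcongr
          exact h2.trans (by gcongr)
      _ = _ := by rw [mul_pow]; ring
  rw [pow_succ'] at h5
  have := le_of_mul_le_mul_right h5 (by positivity)
  linarith

section

variable {V : Type*} [NormedAddCommGroup V] [NormedSpace ℂ V] [FiniteDimensional ℂ V]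

/-- The vectors whose full orbit under `u` is `O(r^k (1 + |k|)^d)`, for `k → +∞` and `k → -∞`. -/
def growthSubmodule (u : (End ℂ V)ˣ) (r : ℝ) (d : ℕ) : Submodule ℂ V where
  carrier := {x | ∃ C : ℝ, ∀ k : ℤ,
    ‖((u ^ k : (End ℂ V)ˣ) : End ℂ V) x‖ ≤ C * (r ^ k * (1 + |(k : ℝ)|) ^ d)}
  zero_mem' := ⟨0, fun k => by simp⟩
  add_mem' := by
    rintro x y ⟨C, hC⟩ ⟨D, hD⟩
    refine ⟨C + D, fun k => ?_⟩
    rw [map_add, add_mul]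
    exact norm_add_le_of_le (hC k) (hD k)
  smul_mem' := by
    rintro c x ⟨C, hC⟩
    refine ⟨‖c‖ * C, fun k => ?_⟩
    rw [map_smul, norm_smul, mul_assoc]
    gcongr
    exact hC k

theorem apply_mem_growthSubmodule (u : (End ℂ V)ˣ) (r : ℝ) (d : ℕ) {x : V}
    (hx : x ∈ growthSubmodule u r d) : (u : End ℂ V) x ∈ growthSubmodule u r d := by
  obtain ⟨C, hC⟩ := hx
  obtain ⟨c, hc0, hc⟩ := exists_norm_apply_le (u : End ℂ V)
  refine ⟨c * C, fun k => ?_⟩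
  rw [← Module.End.mul_apply, ← Units.val_mul, ← zpow_add_one, add_comm, zpow_one_add,
    Units.val_mul, Module.End.mul_apply, mul_assoc]
  exact (hc _).trans (by gcongr; exact hC k)

theorem pow_sub_smul_apply_mem_growthSubmodule (u : (End ℂ V)ˣ) (r : ℝ) (d : ℕ) (μ : ℂ) (j : ℕ)
    {x : V} (hx : x ∈ growthSubmodule u r d) :
    (((u : End ℂ V) - μ • (1 : End ℂ V)) ^ j) x ∈ growthSubmodule u r d := by
  induction j with
  | zero => simpa using hx
  | succ j ih =>
    rw [pow_succ', Module.End.mul_apply, LinearMap.sub_apply, LinearMap.smul_apply,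
      Module.End.one_apply]
    exact sub_mem (apply_mem_growthSubmodule u r d ih) (Submodule.smul_mem _ _ ih)

theorem mem_growthSubmodule_of_pow_apply_eq_zero (u : (End ℂ V)ˣ) {μ : ℂ} (hμ : μ ≠ 0) {d : ℕ}
    {x : V} (hx : (((u : End ℂ V) - μ • (1 : End ℂ V)) ^ (d + 1)) x = 0) :
    x ∈ growthSubmodule u ‖μ‖ d := by
  refine ⟨∑ i ∈ Finset.range (d + 1),
    ‖(μ⁻¹) ^ i • (((u : End ℂ V) - μ • (1 : End ℂ V)) ^ i) x‖, fun k => ?_⟩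
  rw [zpow_apply_eq_sum u hμ hx, norm_smul, norm_zpow, mul_left_comm]
  gcongr
  rw [Finset.sum_mul]
  refine norm_sum_le_of_le _ fun i hi => ?_
  rw [norm_smul, Complex.norm_real, Real.norm_eq_abs, mul_comm]
  gcongr
  exact (abs_choose_le _ i).trans (pow_le_pow_right₀ (by linarith [abs_nonneg (k : ℝ)])
    (Nat.lt_succ_iff.1 (Finset.mem_range.1 hi)))

/-- The growth of an eigenvector in both time directions determines the modulus of its eigenvalue. -/
theorem norm_eq_of_mem_growthSubmodule {u : (End ℂ V)ˣ} {r : ℝ} (hr : 0 < r) {d : ℕ} {μ : ℂ}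
    (hμ : μ ≠ 0) {x : V} (hx : x ∈ growthSubmodule u r d) (hx0 : x ≠ 0)
    (h : ((u : End ℂ V) - μ • (1 : End ℂ V)) x = 0) : ‖μ‖ = r := by
  obtain ⟨C, hC⟩ := hx
  have hμ' : 0 < ‖μ‖ := norm_pos_iff.2 hμ
  have hx' : 0 < ‖x‖ := norm_pos_iff.2 hx0
  have : ‖μ‖ / r = 1 := by
    refine eq_one_of_zpow_le_mul_pow (C := C / ‖x‖) (d := d) (by positivity) fun k => ?_
    have hk := hC k
    rw [zpow_apply_eq_sum u hμ (m := 1) (by simpa using h), norm_smul, norm_zpow] at hk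
    simp only [Finset.range_one, Finset.sum_singleton, pow_zero, one_smul, Module.End.one_apply,
      Ring.choose_zero_right, Complex.ofReal_one] at hk
    have hrk : 0 < r ^ k := zpow_pos hr k
    rw [div_zpow, div_le_iff₀ hrk, div_mul_eq_mul_div, div_mul_eq_mul_div, le_div_iff₀ hx']
    linarith
  rwa [div_eq_one_iff_eq hr.ne'] at this

/-- A chain of generalized eigenvectors longer than `d + 1` grows faster than `‖μ‖ ^ k k ^ d`. -/
theorem pow_apply_eq_zero_of_mem_growthSubmodule {u : (End ℂ V)ˣ} {d : ℕ} {μ : ℂ}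
    (hμ : μ ≠ 0) {x : V} (hx : x ∈ growthSubmodule u ‖μ‖ d)
    (h : (((u : End ℂ V) - μ • (1 : End ℂ V)) ^ (d + 2)) x = 0) :
    (((u : End ℂ V) - μ • (1 : End ℂ V)) ^ (d + 1)) x = 0 := by
  by_contra hne
  obtain ⟨C, hC⟩ := hx
  set v : ℕ → V := fun i => (μ⁻¹) ^ i • (((u : End ℂ V) - μ • (1 : End ℂ V)) ^ i) x with hv
  have hμ' : 0 < ‖μ‖ := norm_pos_iff.2 hμ
  have hv0 : 0 < ‖v (d + 1)‖ := by
    rw [norm_pos_iff]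
    exact smul_ne_zero (pow_ne_zero _ (inv_ne_zero hμ)) hne
  -- In the binomial expansion of `u ^ n` the term of degree `d + 1` dominates.
  refine not_forall_choose_le ((C + ∑ i ∈ Finset.range (d + 1), ‖v i‖) / ‖v (d + 1)‖) d
    fun n => ?_
  have hk := hC n
  rw [zpow_apply_eq_sum u hμ h, norm_smul, norm_zpow, mul_left_comm C] at hk
  have hk1 := le_of_mul_le_mul_left hk (zpow_pos hμ' _)
  rw [Finset.sum_range_succ, Int.cast_natCast, Nat.abs_cast] at hk1
  have h2 : ‖∑ i ∈ Finset.range (d + 1), ((Ring.choose (n : ℝ) i : ℝ) : ℂ) • v i‖ ≤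
      (∑ i ∈ Finset.range (d + 1), ‖v i‖) * (1 + n) ^ d := by
    rw [Finset.sum_mul]
    refine norm_sum_le_of_le _ fun i hi => ?_
    rw [norm_smul, Complex.norm_real, Real.norm_eq_abs, mul_comm]
    gcongr
    refine (abs_choose_le _ i).trans ?_
    rw [Nat.abs_cast]
    exact pow_le_pow_right₀ (by linarith [(n.cast_nonneg : (0 : ℝ) ≤ n)])
      (Nat.lt_succ_iff.1 (Finset.mem_range.1 hi))
  have h3 : ‖((Ring.choose (n : ℝ) (d + 1) : ℝ) : ℂ) • v (d + 1)‖ =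
      (n.choose (d + 1) : ℝ) * ‖v (d + 1)‖ := by
    rw [norm_smul, Complex.norm_real, Real.norm_eq_abs, Ring.choose_natCast, Nat.abs_cast]
  rw [div_mul_eq_mul_div, le_div_iff₀ hv0, ← h3]
  have h4 := norm_sub_le
    ((∑ i ∈ Finset.range (d + 1), ((Ring.choose (n : ℝ) i : ℝ) : ℂ) • v i) +
      ((Ring.choose (n : ℝ) (d + 1) : ℝ) : ℂ) • v (d + 1))
    (∑ i ∈ Finset.range (d + 1), ((Ring.choose (n : ℝ) i : ℝ) : ℂ) • v i)
  rw [add_sub_cancel_left] at h4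
  rw [add_mul]
  exact h4.trans (add_le_add hk1 h2)

theorem mem_growthSubmodule_iff {u : (End ℂ V)ˣ} {d : ℕ} {μ : ℂ} (hμ : μ ≠ 0) {x : V}
    (hx : x ∈ (u : End ℂ V).maxGenEigenspace μ) :
    x ∈ growthSubmodule u ‖μ‖ d ↔ (((u : End ℂ V) - μ • (1 : End ℂ V)) ^ (d + 1)) x = 0 := by
  refine ⟨fun h => ?_, mem_growthSubmodule_of_pow_apply_eq_zero u hμ⟩
  by_contra hne
  have hex := exists_pow_sub_smul_apply_eq_zero hx
  classical
  have hspec := Nat.find_spec hex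
  have hlt : d + 1 < Nat.find hex := by
    by_contra! hle
    obtain ⟨j, hj⟩ := Nat.exists_eq_add_of_le' hle
    apply hne
    rw [hj, pow_add, Module.End.mul_apply, hspec, map_zero]
  obtain ⟨j, hj⟩ := Nat.exists_eq_add_of_le hlt
  refine Nat.find_min hex (m := d + 1 + j) (by omega) ?_
  rw [pow_add, Module.End.mul_apply]
  refine pow_apply_eq_zero_of_mem_growthSubmodule hμ
    (pow_sub_smul_apply_mem_growthSubmodule u _ d μ j h) ?_
  rw [← Module.End.mul_apply, ← pow_add, show d + 2 + j = Nat.find hex by omega]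
  exact hspec

theorem eq_zero_of_mem_growthSubmodule {u : (End ℂ V)ˣ} {r : ℝ} (hr : 0 < r) {d : ℕ} {μ : ℂ}
    (hμr : ‖μ‖ ≠ r) {x : V} (hx : x ∈ (u : End ℂ V).maxGenEigenspace μ)
    (h : x ∈ growthSubmodule u r d) : x = 0 := by
  by_contra hne
  have hμ : μ ≠ 0 := by
    rintro rfl
    rw [maxGenEigenspace_zero_units] at hx
    exact hne hx
  have hex := exists_pow_sub_smul_apply_eq_zero hx
  classical
  have hspec := Nat.find_spec hex
  obtain ⟨j, hj⟩ : ∃ j, Nat.find hex = j + 1 := by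
    refine Nat.exists_eq_succ_of_ne_zero fun h0 => hne ?_
    rw [h0] at hspec
    simpa using hspec
  refine hμr (norm_eq_of_mem_growthSubmodule hr hμ
    (pow_sub_smul_apply_mem_growthSubmodule u r d μ j h) (Nat.find_min hex (by omega)) ?_)
  rwa [← Module.End.mul_apply, ← pow_succ', ← hj]

/-- Orbit growth detects the Jordan structure of `u` on the part of the spectrum of modulus `r`. -/
theorem finrank_growthSubmodule (u : (End ℂ V)ˣ) {r : ℝ} (hr : 0 < r) (d : ℕ) :
    finrank ℂ (growthSubmodule u r d) = ∑ᶠ (μ : ℂ) (_ : ‖μ‖ = r),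
      finrank ℂ (LinearMap.ker (((u : End ℂ V) - μ • (1 : End ℂ V)) ^ (d + 1))) := by
  refine finrank_eq_finsum_finrank_ker_pow _ _ (fun x hx => apply_mem_growthSubmodule u r d hx) _ _
    (fun μ hμ x hx => ?_) fun μ hμ x hx h => eq_zero_of_mem_growthSubmodule hr hμ hx h
  subst hμ
  exact mem_growthSubmodule_iff (norm_pos_iff.1 hr) hx

end

/-! ### Complexification of real matrices -/

section

variable {n : ℕ}

/-- Complexification of real matrices, as a ring homomorphism. -/
noncomputable def complexLinHom (n : ℕ) :
    Matrix (Fin n) (Fin n) ℝ →+* End ℂ (Fin n → ℂ) :=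
  (Matrix.toLinAlgEquiv' (R := ℂ) (n := Fin n)).toRingHom.comp (algebraMap ℝ ℂ).mapMatrix

theorem complexLinHom_apply (A : Matrix (Fin n) (Fin n) ℝ) :
    complexLinHom n A = complexLin A := rfl

theorem complexLin_injective : Function.Injective (complexLin (n := n)) := by
  intro A B h
  have h1 := (Matrix.toLin' (R := ℂ) (n := Fin n) (m := Fin n)).injective h
  exact Matrix.map_injective (algebraMap ℝ ℂ).injective h1

theorem complexLin_mul (A B : Matrix (Fin n) (Fin n) ℝ) :
    complexLin (A * B) = complexLin A * complexLin B := map_mul (complexLinHom n) A B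

theorem complexLin_one : complexLin (1 : Matrix (Fin n) (Fin n) ℝ) = 1 :=
  map_one (complexLinHom n)

theorem complexLin_apply (A : Matrix (Fin n) (Fin n) ℝ) (z : Fin n → ℂ) (i : Fin n) :
    complexLin A z i = ∑ j, (A i j : ℂ) * z j := by
  simp [complexLin, Matrix.toLin'_apply, Matrix.mulVec, dotProduct]

theorem complexLin_ofReal (A : Matrix (Fin n) (Fin n) ℝ) (x : Fin n → ℝ) :
    complexLin A (fun i => (x i : ℂ)) = fun i => ((A.mulVec x i : ℝ) : ℂ) := by
  ext i
  simp [complexLin_apply, Matrix.mulVec, dotProduct]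

theorem re_complexLin (A : Matrix (Fin n) (Fin n) ℝ) (z : Fin n → ℂ) :
    (fun i => (complexLin A z i).re) = A.mulVec fun i => (z i).re := by
  ext i
  simp [complexLin_apply, Matrix.mulVec, dotProduct]

theorem im_complexLin (A : Matrix (Fin n) (Fin n) ℝ) (z : Fin n → ℂ) :
    (fun i => (complexLin A z i).im) = A.mulVec fun i => (z i).im := by
  ext i
  simp [complexLin_apply, Matrix.mulVec, dotProduct]

theorem norm_ofReal_pi (x : Fin n → ℝ) : ‖fun i => (x i : ℂ)‖ = ‖x‖ := by
  simp [Pi.norm_def]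

theorem norm_mulVec_le_of_complexLin {A B : Matrix (Fin n) (Fin n) ℝ} {C : ℝ}
    (h : ∀ z, ‖complexLin A z‖ ≤ C * ‖complexLin B z‖) (x : Fin n → ℝ) :
    ‖A.mulVec x‖ ≤ C * ‖B.mulVec x‖ := by
  have := h fun i => (x i : ℂ)
  rwa [complexLin_ofReal, complexLin_ofReal, norm_ofReal_pi, norm_ofReal_pi] at this

theorem norm_re_pi_le (z : Fin n → ℂ) : ‖fun i => (z i).re‖ ≤ ‖z‖ :=
  (pi_norm_le_iff_of_nonneg (norm_nonneg _)).2 fun i =>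
    (Complex.abs_re_le_norm _).trans (norm_le_pi_norm z i)

theorem norm_im_pi_le (z : Fin n → ℂ) : ‖fun i => (z i).im‖ ≤ ‖z‖ :=
  (pi_norm_le_iff_of_nonneg (norm_nonneg _)).2 fun i =>
    (Complex.abs_im_le_norm _).trans (norm_le_pi_norm z i)

theorem norm_le_norm_re_add_norm_im (z : Fin n → ℂ) :
    ‖z‖ ≤ ‖fun i => (z i).re‖ + ‖fun i => (z i).im‖ := by
  refine (pi_norm_le_iff_of_nonneg (by positivity)).2 fun i => ?_
  refine (Complex.norm_le_abs_re_add_abs_im _).trans (add_le_add ?_ ?_)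
  · exact norm_le_pi_norm (fun i => (z i).re) i
  · exact norm_le_pi_norm (fun i => (z i).im) i

theorem norm_complexLin_le_of_mulVec {A B : Matrix (Fin n) (Fin n) ℝ} {C : ℝ} (hC : 0 ≤ C)
    (h : ∀ x, ‖A.mulVec x‖ ≤ C * ‖B.mulVec x‖) (z : Fin n → ℂ) :
    ‖complexLin A z‖ ≤ 2 * C * ‖complexLin B z‖ := by
  refine (norm_le_norm_re_add_norm_im _).trans ?_
  rw [re_complexLin, im_complexLin]
  have h1 := h fun i => (z i).re
  have h2 := h fun i => (z i).im
  have h3 := norm_re_pi_le (complexLin B z)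
  have h4 := norm_im_pi_le (complexLin B z)
  rw [re_complexLin B] at h3
  rw [im_complexLin B] at h4
  nlinarith

/-- Extension of scalars preserves the dimension of the kernel. -/
theorem finrank_ker_complexLin (A : Matrix (Fin n) (Fin n) ℝ) :
    finrank ℂ (LinearMap.ker (complexLin A)) = finrank ℝ (LinearMap.ker (Matrix.toLin' A)) := by
  let e : LinearMap.ker (complexLin A) ≃ₗ[ℝ]
      LinearMap.ker (Matrix.toLin' A) × LinearMap.ker (Matrix.toLin' A) :=
    { toFun := fun z => (⟨fun i => (z.1 i).re, by
          rw [LinearMap.mem_ker, Matrix.toLin'_apply, ← re_complexLin, LinearMap.mem_ker.1 z.2]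
          rfl⟩, ⟨fun i => (z.1 i).im, by
          rw [LinearMap.mem_ker, Matrix.toLin'_apply, ← im_complexLin, LinearMap.mem_ker.1 z.2]
          rfl⟩)
      invFun := fun p => ⟨fun i => ⟨p.1.1 i, p.2.1 i⟩, by
        have h1 := LinearMap.mem_ker.1 p.1.2
        have h2 := LinearMap.mem_ker.1 p.2.2
        rw [Matrix.toLin'_apply] at h1 h2
        rw [LinearMap.mem_ker]
        ext i
        apply Complex.ext
        · exact congrFun ((re_complexLin A fun i => ⟨p.1.1 i, p.2.1 i⟩).trans h1) i
        · exact congrFun ((im_complexLin A fun i => ⟨p.1.1 i, p.2.1 i⟩).trans h2) i⟩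
      map_add' := fun z w => by ext <;> simp
      map_smul' := fun c z => by ext <;> simp
      left_inv := fun z => by ext i; simp
      right_inv := fun p => by ext i <;> simp }
  have h1 := e.finrank_eq
  have h2 := finrank_real_of_complex (LinearMap.ker (complexLin A))
  rw [Module.finrank_prod] at h1
  omega

theorem star_complexLin (A : Matrix (Fin n) (Fin n) ℝ) (z : Fin n → ℂ) :
    complexLin A (star z) = star (complexLin A z) := by
  ext i
  simp [complexLin_apply]

theorem star_aeval_complexLin (A : Matrix (Fin n) (Fin n) ℝ) (p : ℂ[X]) (z : Fin n → ℂ) :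
    aeval (complexLin A) (p.map (starRingEnd ℂ)) (star z) = star (aeval (complexLin A) p z) := by
  induction p using Polynomial.induction_on' with
  | add p q hp hq => simp only [Polynomial.map_add, map_add, LinearMap.add_apply, hp, hq, star_add]
  | monomial k a =>
    rw [Polynomial.map_monomial, aeval_monomial, aeval_monomial, Module.End.mul_apply,
      Module.End.mul_apply, Module.algebraMap_end_apply, Module.algebraMap_end_apply, star_smul]
    have : ((complexLin A) ^ k) (star z) = star (((complexLin A) ^ k) z) := by
      rw [← complexLinHom_apply, ← map_pow]
      exact star_complexLin _ _
    rw [this]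
    rfl

theorem star_mem_maxGenEigenspace {A : Matrix (Fin n) (Fin n) ℝ} {μ : ℂ} {z : Fin n → ℂ}
    (hz : z ∈ (complexLin A).maxGenEigenspace μ) :
    star z ∈ (complexLin A).maxGenEigenspace (starRingEnd ℂ μ) := by
  obtain ⟨k, hk⟩ := exists_pow_sub_smul_apply_eq_zero hz
  rw [Module.End.mem_maxGenEigenspace]
  refine ⟨k, ?_⟩
  have := star_aeval_complexLin A ((X - C μ) ^ k) z
  rw [aeval_X_sub_C_pow, hk, star_zero, Polynomial.map_pow, Polynomial.map_sub, Polynomial.map_X,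
    Polynomial.map_C, aeval_X_sub_C_pow] at this
  exact this

/-- An operator on `ℂⁿ` that commutes with complex conjugation comes from a real matrix. -/
theorem exists_complexLin_eq {F : End ℂ (Fin n → ℂ)} (hF : ∀ z, F (star z) = star (F z)) :
    ∃ B : Matrix (Fin n) (Fin n) ℝ, complexLin B = F := by
  refine ⟨(LinearMap.toMatrix' F).map Complex.re, ?_⟩
  rw [complexLin, ← LinearEquiv.eq_symm_apply, Matrix.toLin'_symm]
  ext i j
  have h := congrFun (hF (Pi.single j 1)) i
  have h1 : star (Pi.single j 1 : Fin n → ℂ) = Pi.single j 1 := by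
    ext k
    by_cases hk : k = j
    · subst hk; simp
    · simp [Pi.single_eq_of_ne hk]
  rw [h1, Pi.star_apply] at h
  have h2 := Complex.conj_eq_iff_re.1 h.symm
  simpa [LinearMap.toMatrix'_apply] using h2

/-- An operator defined by a conjugation-equivariant family of local polynomials commutes with
conjugation, since conjugation exchanges the generalized eigenspaces of `μ` and `conj μ`. -/
theorem IsLocalPolynomial.star_apply {A : Matrix (Fin n) (Fin n) ℝ} {g : ℂ → ℂ[X]}
    {F : End ℂ (Fin n → ℂ)} (hF : IsLocalPolynomial (complexLin A) g F)
    (hg : ∀ μ, g (starRingEnd ℂ μ) = (g μ).map (starRingEnd ℂ)) (z : Fin n → ℂ) :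
    F (star z) = star (F z) := by
  let F' : End ℂ (Fin n → ℂ) :=
    { toFun := fun z => star (F (star z))
      map_add' := fun x y => by simp
      map_smul' := fun c x => by simp [star_smul] }
  have hF' : IsLocalPolynomial (complexLin A) g F' := by
    intro μ x hx
    show star (F (star x)) = _
    rw [hF _ _ (star_mem_maxGenEigenspace hx), hg, star_aeval_complexLin, star_star]
  have : F = F' := hF.unique hF' fun _ _ _ => rfl
  conv_lhs => rw [this]
  show star (F (star (star z))) = _
  rw [star_star]

end

/-! ### The positive one-parameter group of a real matrix -/

section

variable {n : ℕ}

theorem unipotentPow_conj (d : ℕ) (μ : ℂ) (t : ℝ) :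
    unipotentPow d (starRingEnd ℂ μ) t = (unipotentPow d μ t).map (starRingEnd ℂ) := by
  rw [unipotentPow_eq_sum, unipotentPow_eq_sum, Polynomial.map_sum]
  refine Finset.sum_congr rfl fun i _ => ?_
  simp

theorem eval_unipotentPow {d : ℕ} (hd : 1 ≤ d) {μ : ℂ} (hμ : μ ≠ 0) (t : ℝ) :
    (unipotentPow d μ t).eval μ = 1 := by
  obtain ⟨d, rfl⟩ := Nat.exists_eq_add_of_le' hd
  rw [unipotentPow_eq_sum, eval_finsetSum, Finset.sum_range_succ',
    Finset.sum_eq_zero fun i _ => by simp [hμ]]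
  simp

theorem eval_derivative_unipotentPow {d : ℕ} (hd : 2 ≤ d) {μ : ℂ} (hμ : μ ≠ 0) (t : ℝ) :
    (derivative (unipotentPow d μ t)).eval μ = t * μ⁻¹ := by
  obtain ⟨d, rfl⟩ := Nat.exists_eq_add_of_le' hd
  rw [unipotentPow_eq_sum, derivative_sum, eval_finsetSum, Finset.sum_range_succ',
    Finset.sum_range_succ', Finset.sum_eq_zero fun i _ => by simp [hμ, derivative_pow]]
  simp

/-- The positive real power `|λ|^t (λ⁻¹ A)^t` of the part of `A` that is left after its unimodular
semisimple factor has been removed, as an operator on `ℂⁿ`. -/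
noncomputable def complexModulusPow (A : Matrix (Fin n) (Fin n) ℝ) (t : ℝ) :
    End ℂ (Fin n → ℂ) :=
  twistedPow (complexLin A) (fun μ => ((‖μ‖ ^ t : ℝ) : ℂ)) t

theorem exists_complexLin_eq_complexModulusPow (A : Matrix (Fin n) (Fin n) ℝ) (t : ℝ) :
    ∃ B : Matrix (Fin n) (Fin n) ℝ, complexLin B = complexModulusPow A t := by
  refine exists_complexLin_eq ((isLocalPolynomial_twistedPow _ _ _).star_apply fun μ => ?_)
  simp [unipotentPow_conj]

/-- The real matrix inducing `complexModulusPow A t`; it has only positive eigenvalues. -/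
noncomputable def modulusPow (A : Matrix (Fin n) (Fin n) ℝ) (t : ℝ) :
    Matrix (Fin n) (Fin n) ℝ :=
  (exists_complexLin_eq_complexModulusPow A t).choose

theorem complexLin_modulusPow (A : Matrix (Fin n) (Fin n) ℝ) (t : ℝ) :
    complexLin (modulusPow A t) = complexModulusPow A t :=
  (exists_complexLin_eq_complexModulusPow A t).choose_spec

/-- Complexification of an invertible real matrix. -/
noncomputable def complexUnit (a : (Matrix (Fin n) (Fin n) ℝ)ˣ) : (End ℂ (Fin n → ℂ))ˣ :=
  Units.map (complexLinHom n).toMonoidHom a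

theorem coe_complexUnit (a : (Matrix (Fin n) (Fin n) ℝ)ˣ) :
    ((complexUnit a : (End ℂ (Fin n → ℂ))ˣ) : End ℂ (Fin n → ℂ)) =
      complexLin (a : Matrix (Fin n) (Fin n) ℝ) := rfl

theorem complexLin_zpow (a : (Matrix (Fin n) (Fin n) ℝ)ˣ) (k : ℤ) :
    complexLin ((a ^ k : (Matrix (Fin n) (Fin n) ℝ)ˣ) : Matrix (Fin n) (Fin n) ℝ) =
      ((complexUnit a ^ k : (End ℂ (Fin n → ℂ))ˣ) : End ℂ (Fin n → ℂ)) := by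
  rw [complexUnit, ← map_zpow]
  rfl

theorem maxGenEigenspace_zero_complexLin (a : (Matrix (Fin n) (Fin n) ℝ)ˣ) :
    (complexLin (a : Matrix (Fin n) (Fin n) ℝ)).maxGenEigenspace 0 = ⊥ :=
  maxGenEigenspace_zero_units (complexUnit a)

theorem ne_zero_of_maxGenEigenspace_complexLin {a : (Matrix (Fin n) (Fin n) ℝ)ˣ} {μ : ℂ}
    (hμ : (complexLin (a : Matrix (Fin n) (Fin n) ℝ)).maxGenEigenspace μ ≠ ⊥) : μ ≠ 0 :=
  ne_zero_of_maxGenEigenspace_ne_bot (u := complexUnit a) hμ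

theorem modulusPow_add (a : (Matrix (Fin n) (Fin n) ℝ)ˣ) (s t : ℝ) :
    modulusPow (a : Matrix (Fin n) (Fin n) ℝ) (s + t) =
      modulusPow (a : Matrix (Fin n) (Fin n) ℝ) s * modulusPow (a : Matrix (Fin n) (Fin n) ℝ) t := by
  apply complexLin_injective
  rw [complexLin_mul, complexLin_modulusPow, complexLin_modulusPow, complexLin_modulusPow,
    complexModulusPow, complexModulusPow, complexModulusPow,
    twistedPow_mul (maxGenEigenspace_zero_complexLin a)]
  refine twistedPow_congr (fun μ hμ => ?_) _
  rw [Pi.mul_apply, ← Complex.ofReal_mul,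
    ← Real.rpow_add (norm_pos_iff.2 (ne_zero_of_maxGenEigenspace_complexLin hμ))]

theorem modulusPow_zero (A : Matrix (Fin n) (Fin n) ℝ) : modulusPow A 0 = 1 := by
  apply complexLin_injective
  rw [complexLin_modulusPow, complexModulusPow, complexLin_one, ← twistedPow_one_zero]
  exact twistedPow_congr (fun μ _ => by simp) _

/-- The group `modulusPow` is bounded on bounded sets of times. -/
theorem exists_norm_modulusPow_mulVec_le (a : (Matrix (Fin n) (Fin n) ℝ)ˣ) (T : ℝ) :
    ∃ C : ℝ, 0 ≤ C ∧ ∀ t : ℝ, |t| ≤ T → ∀ x : Fin n → ℝ,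
      ‖(modulusPow (a : Matrix (Fin n) (Fin n) ℝ) t).mulVec x‖ ≤ C * ‖x‖ := by
  set f := complexLin (a : Matrix (Fin n) (Fin n) ℝ) with hf
  obtain ⟨C, hC0, hC⟩ := exists_norm_twistedPow_apply_le f
  have hfin := finite_setOf_maxGenEigenspace_ne_bot f
  set M : ℝ := ∑ μ ∈ hfin.toFinset, (‖μ‖ ^ T + ‖μ‖ ^ (-T)) with hM
  have hM0 : 0 ≤ M := Finset.sum_nonneg fun μ _ => by positivity
  refine ⟨C * M * (1 + |T|) ^ (finrank ℂ (Fin n → ℂ) + 2), by positivity, fun t ht x => ?_⟩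
  have hT : |t| ≤ |T| := ht.trans (le_abs_self T)
  have h1 := hC (fun μ => ((‖μ‖ ^ t : ℝ) : ℂ)) M t (fun μ hμ => ?_) fun i => (x i : ℂ)
  · change ‖complexModulusPow (a : Matrix (Fin n) (Fin n) ℝ) t _‖ ≤ _ at h1
    rw [← complexLin_modulusPow, complexLin_ofReal, norm_ofReal_pi, norm_ofReal_pi] at h1
    exact h1.trans (by gcongr)
  · have hμ0 : 0 < ‖μ‖ := norm_pos_iff.2 (ne_zero_of_maxGenEigenspace_complexLin hμ)
    rw [Complex.norm_real, Real.norm_eq_abs, abs_of_nonneg (by positivity)]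
    have h2 : ‖μ‖ ^ T + ‖μ‖ ^ (-T) ≤ M :=
      Finset.single_le_sum (f := fun μ : ℂ => ‖μ‖ ^ T + ‖μ‖ ^ (-T))
        (fun μ _ => by positivity) (by simpa using hμ)
    refine le_trans ?_ h2
    have h3 : 0 ≤ ‖μ‖ ^ T := by positivity
    have h4 : 0 ≤ ‖μ‖ ^ (-T) := by positivity
    rcases le_total 1 ‖μ‖ with h | h
    · linarith [Real.rpow_le_rpow_of_exponent_le h (abs_le.1 ht).2]
    · linarith [Real.rpow_le_rpow_of_exponent_ge hμ0 h (abs_le.1 ht).1]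

theorem exists_norm_twistedPow_zero_le (f : End ℂ (Fin n → ℂ)) :
    ∃ C : ℝ, 0 ≤ C ∧ ∀ χ : ℂ → ℂ, (∀ μ, f.maxGenEigenspace μ ≠ ⊥ → ‖χ μ‖ ≤ 1) →
      ∀ x, ‖twistedPow f χ 0 x‖ ≤ C * ‖x‖ := by
  obtain ⟨C, hC0, hC⟩ := exists_norm_twistedPow_apply_le f
  refine ⟨C, hC0, fun χ hχ x => ?_⟩
  simpa using hC χ 1 0 hχ x

/-- Integer powers of `A` and of its positive part differ by powers of a diagonalizable operator
with unimodular eigenvalues, hence have comparable size. -/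
theorem exists_norm_zpow_le_modulusPow (a : (Matrix (Fin n) (Fin n) ℝ)ˣ) :
    ∃ C : ℝ, 0 ≤ C ∧ ∀ (k : ℤ) (x : Fin n → ℝ),
      ‖((a ^ k : (Matrix (Fin n) (Fin n) ℝ)ˣ) : Matrix (Fin n) (Fin n) ℝ).mulVec x‖ ≤
          C * ‖(modulusPow (a : Matrix (Fin n) (Fin n) ℝ) k).mulVec x‖ ∧
      ‖(modulusPow (a : Matrix (Fin n) (Fin n) ℝ) k).mulVec x‖ ≤
          C * ‖((a ^ k : (Matrix (Fin n) (Fin n) ℝ)ˣ) : Matrix (Fin n) (Fin n) ℝ).mulVec x‖ := by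
  set f := complexLin (a : Matrix (Fin n) (Fin n) ℝ) with hf
  have hf0 : f.maxGenEigenspace 0 = ⊥ := maxGenEigenspace_zero_complexLin a
  obtain ⟨C, hC0, hC⟩ := exists_norm_twistedPow_zero_le f
  refine ⟨C, hC0, fun k x => ⟨?_, ?_⟩⟩
  · refine norm_mulVec_le_of_complexLin (fun z => ?_) x
    have h := hC (fun μ => μ ^ k / ((‖μ‖ ^ (k : ℝ) : ℝ) : ℂ)) (fun μ hμ => ?_)
      (complexLin (modulusPow (a : Matrix (Fin n) (Fin n) ℝ) k) z)
    · convert h using 2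
      rw [complexLin_zpow, ← twistedPow_zpow, complexLin_modulusPow, complexModulusPow,
        ← Module.End.mul_apply, twistedPow_mul hf0, zero_add]
      refine congrArg (fun F : End ℂ (Fin n → ℂ) => F z) (twistedPow_congr (fun μ hμ => ?_) _)
      have hμ0 : 0 < ‖μ‖ := norm_pos_iff.2 (ne_zero_of_maxGenEigenspace_complexLin hμ)
      rw [Pi.mul_apply, div_mul_cancel₀]
      exact Complex.ofReal_ne_zero.2 (Real.rpow_pos_of_pos hμ0 _).ne'
    · have hμ0 : 0 < ‖μ‖ := norm_pos_iff.2 (ne_zero_of_maxGenEigenspace_complexLin hμ)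
      rw [norm_div, norm_zpow, Complex.norm_real, Real.norm_eq_abs, Real.rpow_intCast,
        abs_of_pos (zpow_pos hμ0 _), div_self (zpow_pos hμ0 _).ne']
  · refine norm_mulVec_le_of_complexLin (fun z => ?_) x
    have h := hC (fun μ => ((‖μ‖ ^ (k : ℝ) : ℝ) : ℂ) / μ ^ k) (fun μ hμ => ?_)
      (complexLin ((a ^ k : (Matrix (Fin n) (Fin n) ℝ)ˣ) : Matrix (Fin n) (Fin n) ℝ) z)
    · convert h using 2
      rw [complexLin_zpow, ← twistedPow_zpow, complexLin_modulusPow, complexModulusPow,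
        ← Module.End.mul_apply, coe_complexUnit, twistedPow_mul hf0, zero_add]
      refine congrArg (fun F : End ℂ (Fin n → ℂ) => F z) (twistedPow_congr (fun μ hμ => ?_) _)
      rw [Pi.mul_apply, div_mul_cancel₀]
      exact zpow_ne_zero _ (ne_zero_of_maxGenEigenspace_complexLin hμ)
    · have hμ0 : 0 < ‖μ‖ := norm_pos_iff.2 (ne_zero_of_maxGenEigenspace_complexLin hμ)
      rw [norm_div, norm_zpow, Complex.norm_real, Real.norm_eq_abs, Real.rpow_intCast,
        abs_of_pos (zpow_pos hμ0 _), div_self (zpow_pos hμ0 _).ne']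

theorem finrank_ker_complexModulusPow (a : (Matrix (Fin n) (Fin n) ℝ)ˣ) {t : ℝ} (ht : t ≠ 0)
    (c : ℂ) (m : ℕ) :
    finrank ℂ (LinearMap.ker ((complexModulusPow (a : Matrix (Fin n) (Fin n) ℝ) t -
        c • (1 : End ℂ (Fin n → ℂ))) ^ m)) =
      ∑ᶠ (μ : ℂ) (_ : ((‖μ‖ ^ t : ℝ) : ℂ) = c), kerDim (a : Matrix (Fin n) (Fin n) ℝ) μ m := by
  rw [complexModulusPow, (isLocalPolynomial_twistedPow _ _ _).finrank_ker_pow]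
  · refine finsum_congr fun μ => ?_
    by_cases hμ : μ = 0
    · -- `0` is not an eigenvalue, so its contribution vanishes on both sides.
      have : finrank ℂ (LinearMap.ker ((complexLin (a : Matrix (Fin n) (Fin n) ℝ) -
          μ • (1 : End ℂ (Fin n → ℂ))) ^ m)) = 0 := by
        rw [le_bot_iff.1 ((ker_pow_le_maxGenEigenspace _ μ m).trans
          (hμ ▸ (maxGenEigenspace_zero_complexLin a).le)), finrank_bot]
      simp only [kerDim, this, finsum_zero]
    · simp only [eval_mul, eval_C, eval_unipotentPow (Nat.le_add_left 1 _) hμ, mul_one, kerDim]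
  · intro μ hμ
    have hμ0 := ne_zero_of_maxGenEigenspace_complexLin hμ
    rw [derivative_C_mul, eval_mul, eval_C, eval_derivative_unipotentPow (by omega) hμ0]
    have h1 := (Real.rpow_pos_of_pos (norm_pos_iff.2 hμ0) t).ne'
    refine mul_ne_zero (by exact_mod_cast h1) (mul_ne_zero (by exact_mod_cast ht) (inv_ne_zero hμ0))

theorem complexLin_sub_smul_one_pow (A : Matrix (Fin n) (Fin n) ℝ) (c : ℝ) (m : ℕ) :
    complexLin ((A - c • (1 : Matrix (Fin n) (Fin n) ℝ)) ^ m) =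
      (complexLin A - (c : ℂ) • (1 : End ℂ (Fin n → ℂ))) ^ m := by
  rw [← complexLinHom_apply, map_pow, map_sub, complexLinHom_apply]
  congr 2
  ext z i
  simp [complexLinHom_apply, complexLin_apply, Matrix.one_apply, apply_ite Complex.ofReal]

/-- The Jordan structure of the positive real powers: the eigenvalue `c` of `modulusPow A t`
collects all eigenvalues `μ` of `A` with `|μ|^t = c`. -/
theorem finrank_ker_modulusPow (a : (Matrix (Fin n) (Fin n) ℝ)ˣ) {t : ℝ} (ht : t ≠ 0)
    (c : ℝ) (m : ℕ) :
    finrank ℝ (LinearMap.ker ((Matrix.toLin' (modulusPow (a : Matrix (Fin n) (Fin n) ℝ) t) -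
        c • (1 : End ℝ (Fin n → ℝ))) ^ m)) =
      ∑ᶠ (μ : ℂ) (_ : ‖μ‖ ^ t = c), kerDim (a : Matrix (Fin n) (Fin n) ℝ) μ m := by
  have h1 : (Matrix.toLin' (modulusPow (a : Matrix (Fin n) (Fin n) ℝ) t) -
      c • (1 : End ℝ (Fin n → ℝ))) ^ m = Matrix.toLin' ((modulusPow (a : Matrix (Fin n) (Fin n) ℝ) t
        - c • (1 : Matrix (Fin n) (Fin n) ℝ)) ^ m) := by
    rw [Matrix.toLin'_pow, map_sub, map_smul, Matrix.toLin'_one]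
    rfl
  rw [h1, ← finrank_ker_complexLin, complexLin_sub_smul_one_pow, complexLin_modulusPow,
    finrank_ker_complexModulusPow a ht]
  simp only [Complex.ofReal_inj]

/-- The eigenvalues of `modulusPow A t` are the real numbers `|μ| ^ t`. -/
theorem splits_charpoly_modulusPow (a : (Matrix (Fin n) (Fin n) ℝ)ˣ) {t : ℝ} (ht : t ≠ 0) :
    (modulusPow (a : Matrix (Fin n) (Fin n) ℝ) t).charpoly.Splits := by
  refine Splits.of_splits_map (algebraMap ℝ ℂ) (IsAlgClosed.splits _) fun c hc => ?_
  rw [← Matrix.charpoly_map, ← Matrix.charpoly_toLin', mem_roots (LinearMap.charpoly_monic _).ne_zero,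
    ← Module.End.hasEigenvalue_iff_isRoot_charpoly] at hc
  by_contra hne
  have h1 := finrank_ker_complexModulusPow a ht c 1
  rw [← complexLin_modulusPow, pow_one] at h1
  have h2 : ∀ μ : ℂ, ((‖μ‖ ^ t : ℝ) : ℂ) ≠ c := fun μ h => hne ⟨_, h⟩
  simp only [h2, finsum_false, finsum_zero] at h1
  rw [Module.End.hasEigenvalue_iff, Module.End.eigenspace_def] at hc
  exact hc (Submodule.finrank_eq_zero.1 h1)

end

/-! ### Similarity of endomorphisms with split characteristic polynomial -/

section

universe u

variable {K : Type u} [Field K]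

/-- The cyclic `K[X]`-module `K[X] / (X - μ)^k` of a Jordan block of size `k` and eigenvalue `μ`. -/
abbrev JordanBlock (μ : K) (k : ℕ) : Type _ := K[X] ⧸ Ideal.span {(X - C μ) ^ k}

instance jordanBlock_finite (μ : K) (k : ℕ) : Module.Finite K (JordanBlock μ k) :=
  (AdjoinRoot.powerBasis (pow_ne_zero k (X_sub_C_ne_zero μ))).finite

theorem finrank_jordanBlock (μ : K) (k : ℕ) : finrank K (JordanBlock μ k) = k := by
  rw [finrank_quotient_span_eq_natDegree, natDegree_pow, natDegree_X_sub_C, mul_one]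

theorem jordanBlock_mk_eq_zero (μ : K) (k : ℕ) (h : K[X]) :
    (Ideal.Quotient.mk (Ideal.span {(X - C μ) ^ k}) h : JordanBlock μ k) = 0 ↔
      (X - C μ) ^ k ∣ h := by
  rw [Ideal.Quotient.eq_zero_iff_mem, Ideal.mem_span_singleton]

theorem smul_jordanBlock_mk_eq_zero (μ : K) (k : ℕ) (a h : K[X]) :
    a • (Ideal.Quotient.mk (Ideal.span {(X - C μ) ^ k}) h : JordanBlock μ k) = 0 ↔
      (X - C μ) ^ k ∣ a * h :=
  jordanBlock_mk_eq_zero μ k (a * h)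

theorem finrank_torsionBy_jordanBlock_of_ne {μ ν : K} (hμν : μ ≠ ν) (k m : ℕ) :
    finrank K (Submodule.torsionBy K[X] (JordanBlock μ k) ((X - C ν) ^ m)) = 0 := by
  have : Submodule.torsionBy K[X] (JordanBlock μ k) ((X - C ν) ^ m) = ⊥ := by
    rw [eq_bot_iff]
    intro y hy
    obtain ⟨h, rfl⟩ := Ideal.Quotient.mk_surjective y
    rw [Submodule.mem_torsionBy_iff, smul_jordanBlock_mk_eq_zero] at hy
    rw [Submodule.mem_bot, jordanBlock_mk_eq_zero]
    refine IsCoprime.dvd_of_dvd_mul_left ?_ hy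
    exact (isCoprime_X_sub_C_of_isUnit_sub (sub_ne_zero.2 hμν).isUnit).pow
  rw [this]
  exact Module.finrank_zero_of_subsingleton

theorem finrank_torsionBy_jordanBlock (μ : K) (k m : ℕ) :
    finrank K (Submodule.torsionBy K[X] (JordanBlock μ k) ((X - C μ) ^ m)) = min m k := by
  obtain ⟨d, hd⟩ : ∃ d, k = d + min m k := ⟨k - min m k, by omega⟩
  set j := min m k with hj
  have hq : (X - C μ : K[X]) ≠ 0 := X_sub_C_ne_zero μ
  -- The torsion is the image of multiplication by `(X - μ)^(k - j)`, with kernel `(X - μ)^j`.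
  let ψ : K[X] →ₗ[K] JordanBlock μ k :=
    (Algebra.linearMap K[X] (JordanBlock μ k)).restrictScalars K ∘ₗ
      LinearMap.mulLeft K ((X - C μ) ^ d)
  have hψ : ∀ h, ψ h = Ideal.Quotient.mk _ ((X - C μ) ^ d * h) := fun h => rfl
  have hker : LinearMap.ker ψ = (Ideal.span {(X - C μ) ^ j}).restrictScalars K := by
    ext h
    rw [LinearMap.mem_ker, hψ, jordanBlock_mk_eq_zero, Submodule.restrictScalars_mem,
      Ideal.mem_span_singleton]
    nth_rewrite 1 [hd]
    rw [pow_add]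
    exact mul_dvd_mul_iff_left (pow_ne_zero _ hq)
  have hrange : LinearMap.range ψ =
      (Submodule.torsionBy K[X] (JordanBlock μ k) ((X - C μ) ^ m)).restrictScalars K := by
    ext y
    obtain ⟨h, rfl⟩ := Ideal.Quotient.mk_surjective y
    rw [LinearMap.mem_range, Submodule.restrictScalars_mem, Submodule.mem_torsionBy_iff,
      smul_jordanBlock_mk_eq_zero]
    constructor
    · rintro ⟨g, hg⟩
      rw [hψ, ← sub_eq_zero, ← map_sub, jordanBlock_mk_eq_zero] at hg
      have h1 : (X - C μ) ^ k ∣ (X - C μ) ^ m * ((X - C μ) ^ d * g) := by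
        rw [← mul_assoc, ← pow_add]
        exact (pow_dvd_pow _ (by omega)).mul_right g
      have h2 := dvd_sub h1 (hg.mul_left ((X - C μ) ^ m))
      rwa [mul_sub, sub_sub_cancel] at h2
    · intro hdvd
      have hdvd' : (X - C μ) ^ d ∣ h := by
        rcases le_total m k with hmk | hmk
        · rw [show k = m + d by omega, pow_add] at hdvd
          exact (mul_dvd_mul_iff_left (pow_ne_zero _ hq)).1 hdvd
        · rw [show d = 0 by omega, pow_zero]
          exact one_dvd h
      obtain ⟨g, rfl⟩ := hdvd'
      exact ⟨g, rfl⟩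
  have h1 := ψ.quotKerEquivRange.finrank_eq
  rw [hrange, hker, (Submodule.Quotient.restrictScalarsEquiv K _).finrank_eq,
    finrank_jordanBlock] at h1
  exact h1.symm

/-- The torsion of a product is the product of the torsions. -/
def torsionByPiEquiv {R ι : Type*} [CommRing R] (M : ι → Type*) [∀ i, AddCommGroup (M i)]
    [∀ i, Module R (M i)] (a : R) :
    Submodule.torsionBy R (∀ i, M i) a ≃ₗ[R] ∀ i, Submodule.torsionBy R (M i) a where
  toFun x i := ⟨x.1 i, by
    have := x.2
    rw [Submodule.mem_torsionBy_iff] at this ⊢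
    exact congrFun this i⟩
  invFun y := ⟨fun i => (y i).1, by
    rw [Submodule.mem_torsionBy_iff]
    ext i
    exact (Submodule.mem_torsionBy_iff _ _).1 (y i).2⟩
  map_add' _ _ := rfl
  map_smul' _ _ := rfl
  left_inv _ := rfl
  right_inv _ := rfl

/-- An isomorphism of modules restricts to the torsion submodules. -/
def torsionByCongr {R M N : Type*} [CommRing R] [AddCommGroup M] [AddCommGroup N] [Module R M]
    [Module R N] (e : M ≃ₗ[R] N) (a : R) :
    Submodule.torsionBy R M a ≃ₗ[R] Submodule.torsionBy R N a where
  toFun x := ⟨e x.1, by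
    have := x.2
    rw [Submodule.mem_torsionBy_iff] at this ⊢
    rw [← map_smul, this, map_zero]⟩
  invFun x := ⟨e.symm x.1, by
    have := x.2
    rw [Submodule.mem_torsionBy_iff] at this ⊢
    rw [← map_smul, this, map_zero]⟩
  map_add' _ _ := by ext; simp
  map_smul' _ _ := by ext; simp
  left_inv _ := by ext; simp
  right_inv _ := by ext; simp

theorem finrank_torsionBy_pi_jordanBlock [DecidableEq K] {ι : Type*} [Fintype ι] (l : ι → K)
    (k : ι → ℕ) (μ : K) (m : ℕ) :
    finrank K (Submodule.torsionBy K[X] (∀ i, JordanBlock (l i) (k i)) ((X - C μ) ^ m)) =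
      ∑ i, if l i = μ then min m (k i) else 0 := by
  have (i : ι) : Module.Finite K
      (Submodule.torsionBy K[X] (JordanBlock (l i) (k i)) ((X - C μ) ^ m)) :=
    inferInstanceAs (Module.Finite K ((Submodule.torsionBy K[X] (JordanBlock (l i) (k i))
      ((X - C μ) ^ m)).restrictScalars K))
  rw [((torsionByPiEquiv (fun i => JordanBlock (l i) (k i)) ((X - C μ) ^ m)).restrictScalars
    K).finrank_eq, Module.finrank_pi_fintype]
  refine Finset.sum_congr rfl fun i _ => ?_
  split_ifs with h
  · rw [← h, finrank_torsionBy_jordanBlock]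
  · exact finrank_torsionBy_jordanBlock_of_ne h _ _

/-- The number of blocks of a given size is a second difference of the torsion dimensions. -/
theorem two_mul_sum_min {α ι : Type*} [DecidableEq α] [Fintype ι] (l : ι → α) (k : ι → ℕ) (μ : α)
    (m : ℕ) :
    2 * (∑ i, if l i = μ then min (m + 1) (k i) else 0) =
      (∑ i, if l i = μ then min m (k i) else 0) + (∑ i, if l i = μ then min (m + 2) (k i) else 0) +
      ∑ i, if (l i, k i) = (μ, m + 1) then 1 else 0 := by
  rw [Finset.mul_sum, ← Finset.sum_add_distrib, ← Finset.sum_add_distrib]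
  refine Finset.sum_congr rfl fun i _ => ?_
  simp only [Prod.mk.injEq]
  by_cases h1 : l i = μ
  · by_cases h2 : k i = m + 1
    · simp only [h1, h2, and_self, if_true]; omega
    · simp only [h1, h2, and_false, if_true, if_false]; omega
  · simp [h1]

/-- Two finite families of Jordan blocks of positive size whose torsion dimensions agree are the
same up to a permutation of the blocks. -/
theorem exists_equiv_of_sum_min_eq {α ι ι' : Type*} [DecidableEq α] [Fintype ι] [Fintype ι']
    {l : ι → α} {k : ι → ℕ} {l' : ι' → α} {k' : ι' → ℕ} (hk : ∀ i, 0 < k i) (hk' : ∀ i, 0 < k' i)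
    (h : ∀ μ m, (∑ i, if l i = μ then min m (k i) else 0) =
      ∑ i, if l' i = μ then min m (k' i) else 0) :
    ∃ σ : ι ≃ ι', l = l' ∘ σ ∧ k = k' ∘ σ := by
  classical
  have hfib : ∀ y : α × ℕ, Nonempty
      ({i // (l i, k i) = y} ≃ {i // (l' i, k' i) = y}) := by
    rintro ⟨μ, m⟩
    refine ⟨Fintype.equivOfCardEq ?_⟩
    rw [Fintype.card_subtype, Fintype.card_subtype, Finset.card_filter, Finset.card_filter]
    rcases m with - | m
    · rw [Finset.sum_eq_zero, Finset.sum_eq_zero]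
      · intro i _
        simp [(hk' i).ne']
      · intro i _
        simp [(hk i).ne']
    · have h1 := two_mul_sum_min l k μ m
      have h2 := two_mul_sum_min l' k' μ m
      rw [h μ (m + 1), h μ m, h μ (m + 2)] at h1
      omega
  let τ := fun y => (hfib y).some
  let σ : ι ≃ ι' := (Equiv.sigmaFiberEquiv fun i => (l i, k i)).symm.trans
    ((Equiv.sigmaCongrRight τ).trans (Equiv.sigmaFiberEquiv fun i => (l' i, k' i)))
  have hσ : ∀ i, (l' (σ i), k' (σ i)) = (l i, k i) := fun i => (τ (l i, k i) ⟨i, rfl⟩).2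
  exact ⟨σ, funext fun i => (congrArg Prod.fst (hσ i)).symm,
    funext fun i => (congrArg Prod.snd (hσ i)).symm⟩

theorem finrank_torsionBy_AEval {V : Type*} [AddCommGroup V] [Module K V] (f : End K V) (μ : K) (m : ℕ) :
    finrank K (Submodule.torsionBy K[X] (AEval' f) ((X - C μ) ^ m)) =
      finrank K (LinearMap.ker ((f - μ • (1 : End K V)) ^ m)) := by
  rw [← aeval_X_sub_C_pow]
  refine LinearEquiv.finrank_eq
    { toFun := fun x => ⟨(AEval'.of f).symm x.1, ?_⟩
      invFun := fun x => ⟨AEval'.of f x.1, ?_⟩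
      map_add' := fun x y => rfl
      map_smul' := fun c x => rfl
      left_inv := fun x => rfl
      right_inv := fun x => rfl }
  · have := (Submodule.mem_torsionBy_iff _ _).1 x.2
    have h := congrArg (AEval'.of f).symm this
    rw [AEval.of_symm_smul, map_zero] at h
    exact h
  · rw [Submodule.mem_torsionBy_iff, ← AEval.of_aeval_smul, Module.End.smul_def,
      LinearMap.mem_ker.1 x.2, map_zero]

variable {V V' : Type*} [AddCommGroup V] [Module K V] [FiniteDimensional K V]
  [AddCommGroup V'] [Module K V'] [FiniteDimensional K V']

/-- Jordan decomposition of an endomorphism annihilated by a split polynomial. -/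
theorem exists_equiv_pi_jordanBlock (f : End K V) {p : K[X]} (hp0 : p ≠ 0) (hp : p.Splits)
    (hpf : aeval f p = 0) :
    ∃ (ι : Type u) (_ : Fintype ι) (l : ι → K) (k : ι → ℕ), (∀ i, 0 < k i) ∧
      Nonempty (AEval' f ≃ₗ[K[X]] ∀ i, JordanBlock (l i) (k i)) := by
  classical
  have hann : ∀ x : AEval' f, p • x = 0 := by
    intro x
    apply (AEval'.of f).symm.injective
    rw [AEval.of_symm_smul, hpf, zero_smul, map_zero]
  have htor : Module.IsTorsion K[X] (AEval' f) := fun x =>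
    ⟨⟨p, mem_nonZeroDivisors_of_ne_zero hp0⟩, hann x⟩
  obtain ⟨ι, _, q, hq, e, ⟨E⟩⟩ := Module.equiv_directSum_of_isTorsion htor
  let E1 := E.trans (DirectSum.linearEquivFunOnFintype K[X] ι fun i => K[X] ⧸ K[X] ∙ q i ^ e i)
  have hdvd : ∀ i, q i ^ e i ∣ p := by
    intro i
    have h1 : p • (Pi.single i (Submodule.Quotient.mk 1) : ∀ i, K[X] ⧸ K[X] ∙ q i ^ e i) = 0 := by
      rw [← E1.apply_symm_apply (Pi.single i (Submodule.Quotient.mk 1)), ← map_smul, hann, map_zero]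
    have h2 := congrFun h1 i
    rw [Pi.smul_apply, Pi.single_eq_same, ← Submodule.Quotient.mk_smul, Pi.zero_apply,
      Submodule.Quotient.mk_eq_zero, smul_eq_mul, mul_one] at h2
    exact Ideal.mem_span_singleton.1 h2
  have hlin : ∀ i : {i // 0 < e i}, ∃ μ : K, Associated (q i) (X - C μ) := by
    intro i
    have h1 : q i ∣ p := (dvd_pow_self _ i.2.ne').trans (hdvd i)
    have h2 := (hp.of_dvd hp0 h1).degree_eq_one_of_irreducible (hq i)
    obtain ⟨μ, hμ⟩ := exists_root_of_degree_eq_one h2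
    exact ⟨μ, ((irreducible_X_sub_C μ).associated_of_dvd (hq i) (dvd_iff_isRoot.2 hμ)).symm⟩
  choose l hl using hlin
  have hsub : ∀ i, ¬ 0 < e i → Subsingleton (K[X] ⧸ K[X] ∙ q i ^ e i) := by
    intro i hi
    rw [Submodule.Quotient.subsingleton_iff, show e i = 0 by omega, pow_zero]
    exact Ideal.span_singleton_one
  let R : (∀ i, K[X] ⧸ K[X] ∙ q i ^ e i) →ₗ[K[X]]
      ∀ i : {i // 0 < e i}, K[X] ⧸ K[X] ∙ q i ^ e i :=
    LinearMap.pi fun i => LinearMap.proj i.1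
  have hR : Function.Bijective R := by
    constructor
    · intro x y hxy
      ext i
      by_cases hi : 0 < e i
      · exact congrFun hxy ⟨i, hi⟩
      · have := hsub i hi
        exact Subsingleton.elim _ _
    · intro y
      refine ⟨fun i => if hi : 0 < e i then y ⟨i, hi⟩ else 0, ?_⟩
      ext i
      simp [R, i.2]
  have hspan : ∀ i : {i // 0 < e i},
      (K[X] ∙ q i ^ e i) = Ideal.span {(X - C (l i)) ^ e i} := fun i =>
    Ideal.span_singleton_eq_span_singleton.2 ((hl i).pow_pow)
  exact ⟨{i // 0 < e i}, inferInstance, l, fun i => e i, fun i => i.2,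
    ⟨(E1.trans (LinearEquiv.ofBijective R hR)).trans
      (LinearEquiv.piCongrRight fun i => Submodule.quotEquivOfEq _ _ (hspan i))⟩⟩

/-- Endomorphisms with split characteristic polynomial are similar as soon as the dimensions of the
kernels of all powers of `f - μ` agree. -/
theorem exists_linearEquiv_conj {f : End K V} {g : End K V'} {p p' : K[X]} (hp0 : p ≠ 0)
    (hp : p.Splits) (hpf : aeval f p = 0) (hp0' : p' ≠ 0) (hp' : p'.Splits) (hpg : aeval g p' = 0)
    (h : ∀ (μ : K) (m : ℕ), finrank K (LinearMap.ker ((f - μ • (1 : End K V)) ^ m)) =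
      finrank K (LinearMap.ker ((g - μ • (1 : End K V')) ^ m))) :
    ∃ e : V ≃ₗ[K] V', ∀ x, e (f x) = g (e x) := by
  classical
  obtain ⟨ι, _, l, k, hk, ⟨E⟩⟩ := exists_equiv_pi_jordanBlock f hp0 hp hpf
  obtain ⟨ι', _, l', k', hk', ⟨E'⟩⟩ := exists_equiv_pi_jordanBlock g hp0' hp' hpg
  obtain ⟨σ, rfl, rfl⟩ := exists_equiv_of_sum_min_eq hk hk' (l := l) (l' := l') fun μ m => by
    rw [← finrank_torsionBy_pi_jordanBlock, ← finrank_torsionBy_pi_jordanBlock,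
      ← ((torsionByCongr E _).restrictScalars K).finrank_eq,
      ← ((torsionByCongr E' _).restrictScalars K).finrank_eq, finrank_torsionBy_AEval,
      finrank_torsionBy_AEval, h]
  let F : AEval' f ≃ₗ[K[X]] AEval' g := (E.trans (LinearEquiv.piCongrLeft K[X]
    (fun j => JordanBlock (l' j) (k' j)) σ)).trans E'.symm
  refine ⟨((AEval'.of f).trans (F.restrictScalars K)).trans (AEval'.of g).symm, fun x => ?_⟩
  simp only [LinearEquiv.trans_apply, LinearEquiv.restrictScalars_apply]
  rw [← AEval'.X_smul_of, map_smul, AEval'.of_symm_X_smul]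

end

/-! ### Quasi-norms associated with a dilation -/

section

variable {n : ℕ}

theorem IsDilation.one_lt_norm {A : Matrix (Fin n) (Fin n) ℝ} (hA : IsDilation A) {μ : ℂ}
    (hμ : (complexLin A).maxGenEigenspace μ ≠ ⊥) : 1 < ‖μ‖ := by
  refine hA μ ?_
  have h : (complexLin A).HasUnifEigenvalue μ ⊤ := hμ
  exact h.lt zero_lt_one

theorem IsDilation.isUnit {A : Matrix (Fin n) (Fin n) ℝ} (hA : IsDilation A) : IsUnit A := by
  rw [Matrix.isUnit_iff_isUnit_det, isUnit_iff_ne_zero]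
  intro hdet
  have h1 : (A.map (algebraMap ℝ ℂ)).det = 0 := by
    have := (algebraMap ℝ ℂ).map_det A
    rw [hdet, map_zero] at this
    exact this.symm
  obtain ⟨v, hv0, hv⟩ := Matrix.exists_mulVec_eq_zero_iff.2 h1
  have h2 : (complexLin A).HasEigenvalue 0 := by
    refine Module.End.hasEigenvalue_of_hasEigenvector (x := v) ⟨?_, hv0⟩
    rw [Module.End.mem_eigenspace_iff, zero_smul]
    exact hv
  have := hA 0 h2
  rw [norm_zero] at this
  linarith

theorem exists_norm_mulVec_le (A : Matrix (Fin n) (Fin n) ℝ) :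
    ∃ C : ℝ, 0 < C ∧ ∀ x, ‖A.mulVec x‖ ≤ C * ‖x‖ := by
  obtain ⟨C, hC⟩ := (LinearMap.toContinuousLinearMap (Matrix.toLin' A)).bound
  exact ⟨C, hC.1, hC.2⟩

/-- Negative powers of a dilation contract to zero uniformly. -/
theorem exists_norm_zpow_neg_mulVec_le {a : (Matrix (Fin n) (Fin n) ℝ)ˣ}
    (ha : IsDilation (a : Matrix (Fin n) (Fin n) ℝ)) {δ : ℝ} (hδ : 0 < δ) :
    ∃ N : ℕ, ∀ k : ℕ, N ≤ k → ∀ x : Fin n → ℝ,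
      ‖((a ^ (-(k : ℤ)) : (Matrix (Fin n) (Fin n) ℝ)ˣ) : Matrix (Fin n) (Fin n) ℝ).mulVec x‖ ≤
        δ * ‖x‖ := by
  set f := complexLin (a : Matrix (Fin n) (Fin n) ℝ) with hf
  obtain ⟨C, hC0, hC⟩ := exists_norm_twistedPow_apply_le f
  have hfin := finite_setOf_maxGenEigenspace_ne_bot f
  obtain ⟨q, hq, hq0, hq1⟩ : ∃ q : ℝ, (∀ μ ∈ hfin.toFinset, ‖μ‖⁻¹ < q) ∧ 0 < q ∧ q < 1 := by
    have h1 : ∀ᶠ q : ℝ in nhdsWithin 1 (Set.Iio 1), ∀ μ ∈ hfin.toFinset, ‖μ‖⁻¹ < q := by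
      rw [Filter.eventually_all_finset]
      intro μ hμ
      have := ha.one_lt_norm (μ := μ) (by simpa using hμ)
      filter_upwards [Ioo_mem_nhdsLT (inv_lt_one_of_one_lt₀ this)] with q hq using hq.1
    obtain ⟨q, hq, hq'⟩ := (h1.and (Ioo_mem_nhdsLT (zero_lt_one' ℝ))).exists
    exact ⟨q, hq, hq'.1, hq'.2⟩
  set d := finrank ℂ (Fin n → ℂ) + 2
  have hlim : Filter.Tendsto (fun k : ℕ => C * q⁻¹ * (((k + 1 : ℕ) : ℝ) ^ d * q ^ (k + 1)))
      Filter.atTop (nhds (C * q⁻¹ * 0)) :=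
    (((tendsto_pow_const_mul_const_pow_of_abs_lt_one d (by rwa [abs_of_pos hq0])).comp
      (Filter.tendsto_add_atTop_nat 1))).const_mul _
  rw [mul_zero] at hlim
  obtain ⟨N, hN⟩ := Filter.eventually_atTop.1 (hlim.eventually_lt_const hδ)
  refine ⟨N, fun k hk x => ?_⟩
  have h1 := hC (fun μ => μ ^ (-(k : ℤ))) (q ^ k) ((-(k : ℤ) : ℤ) : ℝ) (fun μ hμ => ?_)
    fun i => (x i : ℂ)
  · have h2 := twistedPow_zpow (complexUnit a) (-(k : ℤ))
    rw [coe_complexUnit] at h2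
    rw [h2, ← complexLin_zpow, complexLin_ofReal, norm_ofReal_pi, norm_ofReal_pi] at h1
    refine h1.trans ?_
    gcongr
    refine le_trans (le_of_eq ?_) (hN k hk).le
    push_cast
    rw [abs_neg, Nat.abs_cast, pow_succ]
    field_simp
    ring
  · rw [zpow_neg, zpow_natCast, norm_inv, norm_pow, ← inv_pow]
    exact pow_le_pow_left₀ (by positivity) (hq μ (by simpa using hμ)).le k

/-- The determinants of the negative powers of `A` tend to `det 0 = 0`. -/
theorem IsDilation.one_lt_abs_det {A : Matrix (Fin n) (Fin n) ℝ} (hA : IsDilation A)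
    (hn : 0 < n) : 1 < |A.det| := by
  obtain ⟨a, rfl⟩ := hA.isUnit
  by_contra! hdet
  have hdet0 : 0 < |(a : Matrix (Fin n) (Fin n) ℝ).det| := by
    rw [abs_pos]
    exact ((Matrix.isUnit_iff_isUnit_det _).1 a.isUnit).ne_zero
  let B : ℕ → Matrix (Fin n) (Fin n) ℝ := fun k =>
    ((a ^ (-(k : ℤ)) : (Matrix (Fin n) (Fin n) ℝ)ˣ) : Matrix (Fin n) (Fin n) ℝ)
  have hB : Filter.Tendsto B Filter.atTop (nhds 0) := by
    refine tendsto_pi_nhds.2 fun i => tendsto_pi_nhds.2 fun j => ?_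
    rw [Metric.tendsto_atTop]
    intro ε hε
    obtain ⟨N, hN⟩ := exists_norm_zpow_neg_mulVec_le hA (half_pos hε)
    refine ⟨N, fun k hk => ?_⟩
    have h1 := (norm_le_pi_norm _ i).trans (hN k hk (Pi.single j 1))
    rw [Matrix.mulVec_single_one, Pi.norm_single, norm_one, mul_one] at h1
    rw [Matrix.zero_apply, dist_zero_right]
    exact lt_of_le_of_lt h1 (half_lt_self hε)
  have hdetB := ((continuous_id.matrix_det (n := Fin n) (R := ℝ)).tendsto 0).comp hB
  have : Nonempty (Fin n) := ⟨⟨0, hn⟩⟩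
  simp only [id, Matrix.det_zero] at hdetB
  obtain ⟨k, hk⟩ := (hdetB.abs.eventually_lt_const (u := 1) (by simp)).exists
  have h2 : B k * (a : Matrix (Fin n) (Fin n) ℝ) ^ k = 1 := by
    show ((a ^ (-(k : ℤ)) : (Matrix (Fin n) (Fin n) ℝ)ˣ) : Matrix (Fin n) (Fin n) ℝ) * _ = 1
    rw [← Units.val_pow_eq_pow_val, ← Units.val_mul, zpow_neg, zpow_natCast, inv_mul_cancel,
      Units.val_one]
  have h3 := congrArg (fun M => |Matrix.det M|) h2
  simp only [Matrix.det_mul, Matrix.det_pow, abs_mul, abs_pow, Matrix.det_one, abs_one] at h3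
  have h4 : |(a : Matrix (Fin n) (Fin n) ℝ).det| ^ k ≤ 1 := pow_le_one₀ (abs_nonneg _) hdet
  have h5 : 0 < |(a : Matrix (Fin n) (Fin n) ℝ).det| ^ k := by positivity
  simp only [Function.comp_apply] at hk
  nlinarith

namespace IsAssociatedQuasiNorm

variable {a : (Matrix (Fin n) (Fin n) ℝ)ˣ} {ρ : (Fin n → ℝ) → ℝ}

theorem zpow_mulVec (hρ : IsAssociatedQuasiNorm (a : Matrix (Fin n) (Fin n) ℝ) ρ) (k : ℤ)
    (x : Fin n → ℝ) :
    ρ (((a ^ k : (Matrix (Fin n) (Fin n) ℝ)ˣ) : Matrix (Fin n) (Fin n) ℝ).mulVec x) =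
      |(a : Matrix (Fin n) (Fin n) ℝ).det| ^ k * ρ x := by
  have hb : |(a : Matrix (Fin n) (Fin n) ℝ).det| ≠ 0 :=
    abs_ne_zero.2 ((Matrix.isUnit_iff_isUnit_det _).1 a.isUnit).ne_zero
  induction k using Int.induction_on with
  | zero => simp
  | succ k ih =>
    rw [add_comm, zpow_one_add, Units.val_mul, ← Matrix.mulVec_mulVec, hρ.homogeneous, ih,
      zpow_one_add₀ hb, mul_assoc]
  | pred k ih =>
    have h1 : (a : Matrix (Fin n) (Fin n) ℝ).mulVec
        (((a ^ (-(k : ℤ) - 1) : (Matrix (Fin n) (Fin n) ℝ)ˣ) :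
          Matrix (Fin n) (Fin n) ℝ).mulVec x) =
        ((a ^ (-(k : ℤ)) : (Matrix (Fin n) (Fin n) ℝ)ˣ) : Matrix (Fin n) (Fin n) ℝ).mulVec x := by
      rw [Matrix.mulVec_mulVec, ← Units.val_mul, ← zpow_one_add, add_sub_cancel]
    rw [← h1, hρ.homogeneous] at ih
    rw [zpow_sub_one₀ hb]
    rw [mul_right_comm, ← ih]
    field_simp

/-- A measurable quasi-norm is bounded near the origin: some sublevel set has positive measure, so
by Steinhaus its difference set is a neighbourhood of the origin. -/
theorem exists_bound_near_zero {A : Matrix (Fin n) (Fin n) ℝ} (hρ : IsAssociatedQuasiNorm A ρ) :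
    ∃ r : ℝ, 0 < r ∧ ∃ M : ℝ, 0 ≤ M ∧ ∀ x, ‖x‖ < r → ρ x ≤ M := by
  obtain ⟨c, hc0, hc⟩ := hρ.quasi_triangle
  have hneg : NullMeasurable (fun x => ρ (-x)) (volume : Measure (Fin n → ℝ)) :=
    hρ.measurable.comp_quasiMeasurePreserving
      (Measure.measurePreserving_neg (volume : Measure (Fin n → ℝ))).quasiMeasurePreserving
  let E : ℕ → Set (Fin n → ℝ) := fun N => {x | ρ x ≤ N} ∩ {x | ρ (-x) ≤ N}
  have hE : ∀ N, NullMeasurableSet (E N) (volume : Measure (Fin n → ℝ)) := fun N =>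
    (hρ.measurable measurableSet_Iic).inter (hneg measurableSet_Iic)
  have hunion : ⋃ N, E N = Set.univ := by
    refine Set.eq_univ_of_forall fun x => ?_
    obtain ⟨N, hN⟩ := exists_nat_ge (max (ρ x) (ρ (-x)))
    exact Set.mem_iUnion.2 ⟨N, (le_max_left _ _).trans hN, (le_max_right _ _).trans hN⟩
  obtain ⟨N, hN⟩ := exists_measure_pos_of_not_measure_iUnion_null
    (μ := (volume : Measure (Fin n → ℝ))) (s := E)
    (by rw [hunion]; exact isOpen_univ.measure_ne_zero _ Set.univ_nonempty)
  obtain ⟨E', hE'E, hE'm, hE'ae⟩ := (hE N).exists_measurable_subset_ae_eq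
  have hpos : 0 < (volume : Measure (Fin n → ℝ)) E' := by rwa [measure_congr hE'ae]
  have hnhds := Measure.sub_mem_nhds_zero_of_addHaar_pos
    (volume : Measure (Fin n → ℝ)) E' hE'm hpos
  obtain ⟨r, hr, hball⟩ := Metric.mem_nhds_iff.1 hnhds
  refine ⟨r, hr, c * (N + N), by positivity, fun x hx => ?_⟩
  obtain ⟨u, hu, v, hv, rfl⟩ := Set.mem_sub.1 (hball (mem_ball_zero_iff.2 hx))
  rw [sub_eq_add_neg]
  exact (hc u (-v)).trans (mul_le_mul_of_nonneg_left
    (add_le_add (hE'E hu).1 (hE'E hv).2) hc0.le)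

/-- Bounded sets are carried by a negative power of the dilation into the neighbourhood of the origin on
which `ρ` is bounded. -/
theorem exists_bound_of_norm_le (ha : IsDilation (a : Matrix (Fin n) (Fin n) ℝ))
    (hρ : IsAssociatedQuasiNorm (a : Matrix (Fin n) (Fin n) ℝ) ρ) (R : ℝ) :
    ∃ M : ℝ, ∀ x, ‖x‖ ≤ R → ρ x ≤ M := by
  obtain ⟨r, hr, M, hM, h⟩ := hρ.exists_bound_near_zero
  obtain ⟨k, hk⟩ := exists_norm_zpow_neg_mulVec_le ha (δ := r / (|R| + 1)) (by positivity)
  refine ⟨|(a : Matrix (Fin n) (Fin n) ℝ).det| ^ (k : ℤ) * M, fun x hx => ?_⟩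
  have h1 : x = ((a ^ (k : ℤ) : (Matrix (Fin n) (Fin n) ℝ)ˣ) : Matrix (Fin n) (Fin n) ℝ).mulVec
      (((a ^ (-(k : ℤ)) : (Matrix (Fin n) (Fin n) ℝ)ˣ) : Matrix (Fin n) (Fin n) ℝ).mulVec x) := by
    rw [Matrix.mulVec_mulVec, ← Units.val_mul, ← zpow_add, add_neg_cancel, zpow_zero,
      Units.val_one, Matrix.one_mulVec]
  rw [h1, hρ.zpow_mulVec]
  gcongr
  refine h _ (lt_of_le_of_lt (hk k le_rfl x) ?_)
  rw [div_mul_eq_mul_div, div_lt_iff₀ (by positivity)]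
  have := le_abs_self R
  gcongr
  linarith

/-- A quasi-norm associated with a dilation is continuous at the origin. -/
theorem exists_le_of_norm_lt (ha : IsDilation (a : Matrix (Fin n) (Fin n) ℝ)) (hn : 0 < n)
    (hρ : IsAssociatedQuasiNorm (a : Matrix (Fin n) (Fin n) ℝ) ρ) {ε : ℝ} (hε : 0 < ε) :
    ∃ δ : ℝ, 0 < δ ∧ ∀ x, ‖x‖ < δ → ρ x ≤ ε := by
  obtain ⟨r, hr, M, hM, h⟩ := hρ.exists_bound_near_zero
  set b := |(a : Matrix (Fin n) (Fin n) ℝ).det| with hb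
  have hb1 : 1 < b := ha.one_lt_abs_det hn
  obtain ⟨k, hk⟩ := pow_unbounded_of_one_lt (M / ε) hb1
  obtain ⟨C, hC0, hC⟩ := exists_norm_mulVec_le
    ((a ^ (k : ℤ) : (Matrix (Fin n) (Fin n) ℝ)ˣ) : Matrix (Fin n) (Fin n) ℝ)
  refine ⟨r / C, by positivity, fun x hx => ?_⟩
  rw [lt_div_iff₀ hC0] at hx
  have h1 := h _ (lt_of_le_of_lt (hC x) (by linarith))
  rw [hρ.zpow_mulVec, zpow_natCast] at h1
  rw [div_lt_iff₀ hε] at hk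
  have hbk : 0 < b ^ k := by positivity
  by_contra! hlt
  nlinarith

/-- On annuli the quasi-norm is bounded below: the quasi-triangle inequality and continuity at the origin
bound `ρ` from below near each nonzero point, and annuli are compact. -/
theorem exists_le_of_one_le_norm_le (ha : IsDilation (a : Matrix (Fin n) (Fin n) ℝ)) (hn : 0 < n)
    (hρ : IsAssociatedQuasiNorm (a : Matrix (Fin n) (Fin n) ℝ) ρ) (R : ℝ) :
    ∃ δ : ℝ, 0 < δ ∧ ∀ x, 1 ≤ ‖x‖ → ‖x‖ ≤ R → δ ≤ ρ x := by
  obtain ⟨c, hc0, hc⟩ := hρ.quasi_triangle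
  have hcpt : IsCompact (Metric.closedBall (0 : Fin n → ℝ) R ∩ {x | 1 ≤ ‖x‖}) :=
    (isCompact_closedBall _ _).inter_right (isClosed_le continuous_const continuous_norm)
  have := hcpt.induction_on (p := fun s => ∃ δ : ℝ, 0 < δ ∧ ∀ x ∈ s, δ ≤ ρ x)
    ⟨1, one_pos, by simp⟩ (fun s t hst ⟨δ, hδ, h⟩ => ⟨δ, hδ, fun x hx => h x (hst hx)⟩)
    (fun s t ⟨δ, hδ, h⟩ ⟨δ', hδ', h'⟩ => ⟨min δ δ', lt_min hδ hδ', fun x hx => hx.elim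
      (fun hx => (min_le_left _ _).trans (h x hx)) fun hx => (min_le_right _ _).trans (h' x hx)⟩)
    (fun x hx => ?_)
  · obtain ⟨δ, hδ, h⟩ := this
    exact ⟨δ, hδ, fun x hx hx' => h x ⟨mem_closedBall_zero_iff.2 hx', hx⟩⟩
  · have hx0 : x ≠ 0 := by
      rintro rfl
      have := hx.2
      rw [Set.mem_ofPred_eq, norm_zero] at this
      linarith
    have hρx : 0 < ρ x := lt_of_le_of_ne (hρ.nonneg x) fun h => hx0 ((hρ.eq_zero_iff x).1 h.symm)
    obtain ⟨δ, hδ, h⟩ := hρ.exists_le_of_norm_lt ha hn (ε := ρ x / (2 * c)) (by positivity)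
    refine ⟨Metric.ball x δ, mem_nhdsWithin_of_mem_nhds (Metric.ball_mem_nhds x hδ),
      ρ x / (2 * c), by positivity, fun y hy => ?_⟩
    have h1 := h (x - y) (by rwa [← dist_eq_norm, dist_comm])
    have h2 := hc y (x - y)
    rw [add_sub_cancel] at h2
    rw [div_le_iff₀ (by positivity)]
    rw [le_div_iff₀ (by positivity)] at h1
    nlinarith

/-- The sublevel sets of a quasi-norm associated with a dilation are bounded. -/
theorem exists_norm_le_of_le (ha : IsDilation (a : Matrix (Fin n) (Fin n) ℝ)) (hn : 0 < n)
    (hρ : IsAssociatedQuasiNorm (a : Matrix (Fin n) (Fin n) ℝ) ρ) (M : ℝ) :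
    ∃ R : ℝ, ∀ x, ρ x ≤ M → ‖x‖ ≤ R := by
  set b := |(a : Matrix (Fin n) (Fin n) ℝ).det| with hb
  have hb1 : 1 < b := ha.one_lt_abs_det hn
  obtain ⟨C, hC0, hC⟩ := exists_norm_mulVec_le (a : Matrix (Fin n) (Fin n) ℝ)
  obtain ⟨δ, hδ, hann⟩ := hρ.exists_le_of_one_le_norm_le ha hn C
  -- Contract a vector of norm at least one until it reaches the annulus `1 ≤ ‖x‖ ≤ C`.
  have hbig : ∀ y, 1 ≤ ‖y‖ → δ ≤ ρ y := by
    intro y hy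
    have hex : ∃ k : ℕ, ‖((a ^ (-(k : ℤ)) : (Matrix (Fin n) (Fin n) ℝ)ˣ) :
        Matrix (Fin n) (Fin n) ℝ).mulVec y‖ < 1 := by
      obtain ⟨k, hk⟩ := exists_norm_zpow_neg_mulVec_le ha (δ := 1 / (2 * ‖y‖)) (by positivity)
      refine ⟨k, lt_of_le_of_lt (hk k le_rfl y) ?_⟩
      rw [div_mul_eq_mul_div, div_lt_one (by positivity)]
      linarith
    classical
    obtain ⟨j, hj⟩ : ∃ j, Nat.find hex = j + 1 := by
      refine Nat.exists_eq_succ_of_ne_zero fun h0 => ?_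
      have := Nat.find_spec hex
      rw [h0] at this
      simp only [Nat.cast_zero, neg_zero, zpow_zero, Units.val_one, Matrix.one_mulVec] at this
      linarith
    have h1 := not_lt.1 (Nat.find_min hex (m := j) (by omega))
    have h2 := Nat.find_spec hex
    rw [hj] at h2
    set w := ((a ^ (-((j + 1 : ℕ) : ℤ)) : (Matrix (Fin n) (Fin n) ℝ)ˣ) :
        Matrix (Fin n) (Fin n) ℝ).mulVec y with hw
    have h3 : ((a ^ (-(j : ℤ)) : (Matrix (Fin n) (Fin n) ℝ)ˣ) :
        Matrix (Fin n) (Fin n) ℝ).mulVec y = (a : Matrix (Fin n) (Fin n) ℝ).mulVec w := by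
      rw [hw, Matrix.mulVec_mulVec, ← Units.val_mul, ← zpow_one_add]
      congr 3
      push_cast
      ring
    have h4 := hann _ h1 (by
      rw [h3]
      refine (hC w).trans ?_
      nlinarith)
    rw [hρ.zpow_mulVec, zpow_neg, zpow_natCast] at h4
    refine h4.trans (mul_le_of_le_one_left (hρ.nonneg y) ?_)
    exact inv_le_one_of_one_le₀ (one_le_pow₀ hb1.le)
  obtain ⟨k, hk⟩ := pow_unbounded_of_one_lt (M / δ) hb1
  obtain ⟨D, hD0, hD⟩ := exists_norm_mulVec_le
    ((a ^ (k : ℤ) : (Matrix (Fin n) (Fin n) ℝ)ˣ) : Matrix (Fin n) (Fin n) ℝ)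
  refine ⟨D, fun x hx => ?_⟩
  set y := ((a ^ (-(k : ℤ)) : (Matrix (Fin n) (Fin n) ℝ)ˣ) :
    Matrix (Fin n) (Fin n) ℝ).mulVec x with hy
  have hxy : x = ((a ^ (k : ℤ) : (Matrix (Fin n) (Fin n) ℝ)ˣ) :
      Matrix (Fin n) (Fin n) ℝ).mulVec y := by
    rw [hy, Matrix.mulVec_mulVec, ← Units.val_mul, ← zpow_add, add_neg_cancel, zpow_zero,
      Units.val_one, Matrix.one_mulVec]
  have hy1 : ‖y‖ < 1 := by
    by_contra! h
    have h1 := hbig y h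
    have h2 := hx
    rw [hxy, hρ.zpow_mulVec, zpow_natCast] at h2
    rw [div_lt_iff₀ hδ] at hk
    have hbk : 0 < b ^ k := by positivity
    nlinarith
  rw [hxy]
  refine (hD y).trans ?_
  nlinarith

end IsAssociatedQuasiNorm

end

/-! ### Domination of orbits -/

section

variable {n : ℕ}

/-- Passing from the real exponent `k τ` to its integer part costs at most a factor `b`. -/
theorem rpow_mul_floor_bounds {b τ : ℝ} (hb : 1 < b) (k : ℤ) :
    b ^ ⌊(k : ℝ) * τ⌋ ≤ (b ^ τ) ^ k ∧ (b ^ τ) ^ k ≤ b ^ ⌊(k : ℝ) * τ⌋ * b := by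
  have hb0 : 0 < b := by linarith
  have h1 : (b ^ τ) ^ k = b ^ ((k : ℝ) * τ) := by
    rw [← Real.rpow_intCast, ← Real.rpow_mul hb0.le, mul_comm]
  rw [h1]
  constructor
  · rw [← Real.rpow_intCast]
    exact Real.rpow_le_rpow_of_exponent_le hb.le (Int.floor_le _)
  · rw [← zpow_add_one₀ hb0.ne', ← Real.rpow_intCast]
    refine Real.rpow_le_rpow_of_exponent_le hb.le ?_
    push_cast
    exact (Int.lt_floor_add_one _).le

/-- The orbits of `a₂`, transported by `S`, are dominated by those of `a₁` after the change of time
`k ↦ ⌊k τ⌋`. -/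
def OrbitDominated (a₁ a₂ : (Matrix (Fin n) (Fin n) ℝ)ˣ) (S : Matrix (Fin n) (Fin n) ℝ)
    (τ : ℝ) : Prop :=
  ∃ C : ℝ, 0 ≤ C ∧ ∀ (k : ℤ) (x : Fin n → ℝ),
    ‖((a₂ ^ k : (Matrix (Fin n) (Fin n) ℝ)ˣ) : Matrix (Fin n) (Fin n) ℝ).mulVec (S.mulVec x)‖ ≤
      C * ‖((a₁ ^ ⌊(k : ℝ) * τ⌋ : (Matrix (Fin n) (Fin n) ℝ)ˣ) :
        Matrix (Fin n) (Fin n) ℝ).mulVec x‖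

section

variable {a₁ a₂ : (Matrix (Fin n) (Fin n) ℝ)ˣ} {ρ₁ ρ₂ : (Fin n → ℝ) → ℝ}

/-- Quasi-norm inequalities give domination of orbits: boundedness of `ρ₁` on the unit ball passes to
`ρ₂` through `h`, and sublevel sets of `ρ₂` are bounded. -/
theorem OrbitDominated.of_quasiNorm_le (hn : 0 < n)
    (h₁ : IsDilation (a₁ : Matrix (Fin n) (Fin n) ℝ))
    (h₂ : IsDilation (a₂ : Matrix (Fin n) (Fin n) ℝ))
    (hρ₁ : IsAssociatedQuasiNorm (a₁ : Matrix (Fin n) (Fin n) ℝ) ρ₁)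
    (hρ₂ : IsAssociatedQuasiNorm (a₂ : Matrix (Fin n) (Fin n) ℝ) ρ₂)
    {S : Matrix (Fin n) (Fin n) ℝ} {τ c : ℝ} (hc : 0 ≤ c)
    (hτ : |(a₁ : Matrix (Fin n) (Fin n) ℝ).det| ^ τ = |(a₂ : Matrix (Fin n) (Fin n) ℝ).det|)
    (h : ∀ x, ρ₂ (S.mulVec x) ≤ c * ρ₁ x) : OrbitDominated a₁ a₂ S τ := by
  set b₁ := |(a₁ : Matrix (Fin n) (Fin n) ℝ).det|
  set b₂ := |(a₂ : Matrix (Fin n) (Fin n) ℝ).det|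
  have hb₁ : 1 < b₁ := h₁.one_lt_abs_det hn
  have hb₁0 : 0 < b₁ := by linarith
  obtain ⟨M, hM⟩ := hρ₁.exists_bound_of_norm_le h₁ 1
  obtain ⟨R, hR⟩ := hρ₂.exists_norm_le_of_le h₂ hn (b₁ * (c * M))
  have hR0 : 0 ≤ R := by
    have hM0 : 0 ≤ M := (hρ₁.nonneg 0).trans (hM 0 (by simp))
    have := hR 0 (by rw [(hρ₂.eq_zero_iff 0).2 rfl]; positivity)
    rwa [norm_zero] at this
  refine ⟨R, hR0, fun k x => ?_⟩
  obtain ⟨-, hk⟩ := rpow_mul_floor_bounds (τ := τ) hb₁ k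
  rw [hτ] at hk
  set j := ⌊(k : ℝ) * τ⌋
  set y := ((a₁ ^ j : (Matrix (Fin n) (Fin n) ℝ)ˣ) : Matrix (Fin n) (Fin n) ℝ).mulVec x with hy
  by_cases hy0 : y = 0
  · have hx : x = 0 := by
      have : ((a₁ ^ (-j) : (Matrix (Fin n) (Fin n) ℝ)ˣ) : Matrix (Fin n) (Fin n) ℝ).mulVec y = x := by
        rw [hy, Matrix.mulVec_mulVec, ← Units.val_mul, ← zpow_add, neg_add_cancel, zpow_zero,
          Units.val_one, Matrix.one_mulVec]
      rw [← this, hy0, Matrix.mulVec_zero]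
    rw [hx, hy0, Matrix.mulVec_zero, Matrix.mulVec_zero]
    simp
  -- Both sides are homogeneous in `x`, so `x` may be rescaled such that `‖y‖ = 1`.
  have hyn : 0 < ‖y‖ := norm_pos_iff.2 hy0
  have h3 : ρ₁ (((a₁ ^ j : (Matrix (Fin n) (Fin n) ℝ)ˣ) :
      Matrix (Fin n) (Fin n) ℝ).mulVec (‖y‖⁻¹ • x)) ≤ M := by
    refine hM _ ?_
    rw [Matrix.mulVec_smul, norm_smul, norm_inv, norm_norm, inv_mul_cancel₀ hyn.ne']
  rw [hρ₁.zpow_mulVec] at h3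
  have h4 := hR (((a₂ ^ k : (Matrix (Fin n) (Fin n) ℝ)ˣ) :
      Matrix (Fin n) (Fin n) ℝ).mulVec (S.mulVec (‖y‖⁻¹ • x))) (by
    rw [hρ₂.zpow_mulVec]
    calc b₂ ^ k * ρ₂ (S.mulVec (‖y‖⁻¹ • x)) ≤ (b₁ ^ j * b₁) * (c * ρ₁ (‖y‖⁻¹ • x)) :=
          mul_le_mul hk (h _) (hρ₂.nonneg _) (by positivity)
      _ = b₁ * (c * (b₁ ^ j * ρ₁ (‖y‖⁻¹ • x))) := by ring
      _ ≤ _ := by gcongr)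
  rw [Matrix.mulVec_smul, Matrix.mulVec_smul, norm_smul, norm_inv, norm_norm,
    inv_mul_le_iff₀ hyn] at h4
  linarith

/-- Domination of orbits gives a quasi-norm inequality: every `x` is carried by some power of `a₁` to
a point at which `ρ₁` is bounded by a constant. -/
theorem OrbitDominated.quasiNorm_le (hn : 0 < n)
    (h₁ : IsDilation (a₁ : Matrix (Fin n) (Fin n) ℝ))
    (h₂ : IsDilation (a₂ : Matrix (Fin n) (Fin n) ℝ))
    (hρ₁ : IsAssociatedQuasiNorm (a₁ : Matrix (Fin n) (Fin n) ℝ) ρ₁)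
    (hρ₂ : IsAssociatedQuasiNorm (a₂ : Matrix (Fin n) (Fin n) ℝ) ρ₂)
    {S : Matrix (Fin n) (Fin n) ℝ} {τ : ℝ}
    (hτ : |(a₁ : Matrix (Fin n) (Fin n) ℝ).det| ^ τ = |(a₂ : Matrix (Fin n) (Fin n) ℝ).det|)
    (h : OrbitDominated a₁ a₂ S τ) : ∃ c : ℝ, ∀ x, ρ₂ (S.mulVec x) ≤ c * ρ₁ x := by
  set b₁ := |(a₁ : Matrix (Fin n) (Fin n) ℝ).det|
  set b₂ := |(a₂ : Matrix (Fin n) (Fin n) ℝ).det|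
  have hb₁ : 1 < b₁ := h₁.one_lt_abs_det hn
  have hb₂ : 1 < b₂ := h₂.one_lt_abs_det hn
  have hb₂0 : 0 < b₂ := by linarith
  obtain ⟨C, hC0, hC⟩ := h
  obtain ⟨R, hR⟩ := hρ₁.exists_norm_le_of_le h₁ hn b₂
  obtain ⟨M, hM⟩ := hρ₂.exists_bound_of_norm_le h₂ (C * R)
  refine ⟨M, fun x => ?_⟩
  rcases (hρ₁.nonneg x).eq_or_lt with hx | hx
  · rw [(hρ₁.eq_zero_iff x).1 hx.symm, Matrix.mulVec_zero, (hρ₁.eq_zero_iff 0).2 rfl,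
      (hρ₂.eq_zero_iff 0).2 rfl, mul_zero]
  -- Normalize by the power of `a₂` for which `b₂ ^ (-m) * ρ₁ x` lies in `[1, b₂)`.
  obtain ⟨m, hm1, hm2⟩ := exists_mem_Ico_zpow hx hb₂
  obtain ⟨hk, -⟩ := rpow_mul_floor_bounds (τ := τ) hb₁ (-m)
  rw [hτ] at hk
  have hbm : 0 < b₂ ^ m := by positivity
  have h3 := hR (((a₁ ^ ⌊((-m : ℤ) : ℝ) * τ⌋ : (Matrix (Fin n) (Fin n) ℝ)ˣ) :
      Matrix (Fin n) (Fin n) ℝ).mulVec x) (by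
    rw [hρ₁.zpow_mulVec]
    calc b₁ ^ ⌊((-m : ℤ) : ℝ) * τ⌋ * ρ₁ x ≤ b₂ ^ (-m) * b₂ ^ (m + 1) :=
          mul_le_mul hk hm2.le hx.le (by positivity)
      _ = b₂ := by rw [← zpow_add₀ hb₂0.ne', neg_add_cancel_left, zpow_one])
  have h4 := hM _ ((hC (-m) x).trans (by gcongr))
  rw [hρ₂.zpow_mulVec, zpow_neg, inv_mul_le_iff₀ hbm] at h4
  have hM0 : 0 ≤ M := (hρ₂.nonneg _).trans (hM 0 (by
    rw [norm_zero]; exact mul_nonneg hC0 ((norm_nonneg _).trans h3)))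
  calc ρ₂ (S.mulVec x) ≤ b₂ ^ m * M := h4
    _ ≤ M * ρ₁ x := by rw [mul_comm]; gcongr

end

theorem finrank_growthSubmodule_complexUnit (a : (Matrix (Fin n) (Fin n) ℝ)ˣ) {r : ℝ} (hr : 0 < r)
    (d : ℕ) : finrank ℂ (growthSubmodule (complexUnit a) r d) =
      sumKerDim (a : Matrix (Fin n) (Fin n) ℝ) r (d + 1) :=
  finrank_growthSubmodule (complexUnit a) hr d

/-- Domination of orbits forces an inequality between the Jordan data at moduli `s` and `s^τ`. -/
theorem OrbitDominated.sumKerDim_le {a₁ a₂ S : (Matrix (Fin n) (Fin n) ℝ)ˣ} {τ : ℝ}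
    (h : OrbitDominated a₁ a₂ (S : Matrix (Fin n) (Fin n) ℝ) τ) {s : ℝ} (hs : 1 < s) (d : ℕ) :
    sumKerDim (a₁ : Matrix (Fin n) (Fin n) ℝ) s (d + 1) ≤
      sumKerDim (a₂ : Matrix (Fin n) (Fin n) ℝ) (s ^ τ) (d + 1) := by
  have hs0 : 0 < s := by linarith
  rw [← finrank_growthSubmodule_complexUnit a₁ hs0,
    ← finrank_growthSubmodule_complexUnit a₂ (by positivity)]
  obtain ⟨C, hC0, hC⟩ := h
  have hmaps : ∀ z ∈ growthSubmodule (complexUnit a₁) s d,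
      complexLin (S : Matrix (Fin n) (Fin n) ℝ) z ∈ growthSubmodule (complexUnit a₂) (s ^ τ) d := by
    rintro z ⟨D, hD⟩
    have hD0 : 0 ≤ D := by simpa using (norm_nonneg _).trans (hD 0)
    refine ⟨2 * C * D * (2 + |τ|) ^ d, fun k => ?_⟩
    obtain ⟨hk, -⟩ := rpow_mul_floor_bounds (τ := τ) hs k
    have h1 := norm_complexLin_le_of_mulVec
      (A := ((a₂ ^ k : (Matrix (Fin n) (Fin n) ℝ)ˣ) : Matrix (Fin n) (Fin n) ℝ) *
        (S : Matrix (Fin n) (Fin n) ℝ))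
      (B := ((a₁ ^ ⌊(k : ℝ) * τ⌋ : (Matrix (Fin n) (Fin n) ℝ)ˣ) : Matrix (Fin n) (Fin n) ℝ)) hC0
      (fun x => by rw [← Matrix.mulVec_mulVec]; exact hC k x) z
    rw [complexLin_mul, Module.End.mul_apply, complexLin_zpow, complexLin_zpow] at h1
    have h2 := hD ⌊(k : ℝ) * τ⌋
    set j := ⌊(k : ℝ) * τ⌋ with hj
    have h3 : 1 + |(j : ℝ)| ≤ (2 + |τ|) * (1 + |(k : ℝ)|) := by
      have h4 := Int.floor_le ((k : ℝ) * τ)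
      have h5 := Int.lt_floor_add_one ((k : ℝ) * τ)
      have h6 : |(j : ℝ)| ≤ |(k : ℝ)| * |τ| + 1 := by
        rw [← abs_mul, abs_le]
        constructor
        · linarith [neg_abs_le ((k : ℝ) * τ)]
        · linarith [le_abs_self ((k : ℝ) * τ)]
      nlinarith [abs_nonneg (k : ℝ), abs_nonneg τ]
    calc _ ≤ _ := h1
      _ ≤ 2 * C * (D * ((s ^ τ) ^ k * ((2 + |τ|) * (1 + |(k : ℝ)|)) ^ d)) := by
          gcongr
          exact h2.trans (by gcongr)
      _ = _ := by rw [mul_pow]; ring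
  have hinj : Function.Injective (complexLin (S : Matrix (Fin n) (Fin n) ℝ)) := by
    refine Function.LeftInverse.injective (g := complexLin
      ((S⁻¹ : (Matrix (Fin n) (Fin n) ℝ)ˣ) : Matrix (Fin n) (Fin n) ℝ)) fun z => ?_
    rw [← Module.End.mul_apply, ← complexLin_mul, Units.inv_mul, complexLin_one,
      Module.End.one_apply]
  refine LinearMap.finrank_le_finrank_of_injective
    (f := (complexLin (S : Matrix (Fin n) (Fin n) ℝ)).restrict hmaps) fun x y hxy => ?_
  exact Subtype.ext (hinj (congrArg Subtype.val hxy))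

theorem kerDim_eq_zero {A : Matrix (Fin n) (Fin n) ℝ} (hA : IsDilation A) {μ : ℂ} (hμ : ‖μ‖ ≤ 1)
    (m : ℕ) : kerDim A μ m = 0 := by
  by_contra h
  have hbot : (complexLin A).maxGenEigenspace μ ≠ ⊥ := by
    intro h1
    have h2 := ker_pow_le_maxGenEigenspace (complexLin A) μ m
    rw [h1, le_bot_iff] at h2
    exact h (by rw [kerDim, h2, finrank_bot])
  exact absurd (hA.one_lt_norm hbot) (not_lt.2 hμ)

theorem kerDim_zero (A : Matrix (Fin n) (Fin n) ℝ) (μ : ℂ) : kerDim A μ 0 = 0 := by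
  have : LinearMap.ker (1 : End ℂ (Fin n → ℂ)) = ⊥ := LinearMap.ker_id
  rw [kerDim, pow_zero, this, finrank_bot]

/-- If the Jordan data match, the positive parts of `A₁` and of the real power `A₂^ε` are similar
over `ℝ`. -/
theorem exists_conj_modulusPow {a₁ a₂ : (Matrix (Fin n) (Fin n) ℝ)ˣ}
    (h₁ : IsDilation (a₁ : Matrix (Fin n) (Fin n) ℝ))
    (h₂ : IsDilation (a₂ : Matrix (Fin n) (Fin n) ℝ)) {ε : ℝ} (hε : 0 < ε)
    (h : ∀ r : ℝ, 1 < r → ∀ m : ℕ, 1 ≤ m → sumKerDim (a₁ : Matrix (Fin n) (Fin n) ℝ) (r ^ ε) m =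
      sumKerDim (a₂ : Matrix (Fin n) (Fin n) ℝ) r m) :
    ∃ S : (Matrix (Fin n) (Fin n) ℝ)ˣ,
      (S : Matrix (Fin n) (Fin n) ℝ) * modulusPow (a₁ : Matrix (Fin n) (Fin n) ℝ) 1 =
        modulusPow (a₂ : Matrix (Fin n) (Fin n) ℝ) ε * (S : Matrix (Fin n) (Fin n) ℝ) := by
  have hann : ∀ B : Matrix (Fin n) (Fin n) ℝ, aeval (Matrix.toLin' B) B.charpoly = 0 := fun B => by
    rw [← Matrix.charpoly_toLin']
    exact LinearMap.aeval_self_charpoly _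
  have hker : ∀ (c : ℝ) (m : ℕ),
      finrank ℝ (LinearMap.ker ((Matrix.toLin' (modulusPow (a₁ : Matrix (Fin n) (Fin n) ℝ) 1) -
          c • (1 : End ℝ (Fin n → ℝ))) ^ m)) =
        finrank ℝ (LinearMap.ker ((Matrix.toLin' (modulusPow (a₂ : Matrix (Fin n) (Fin n) ℝ) ε) -
          c • (1 : End ℝ (Fin n → ℝ))) ^ m)) := by
    intro c m
    rw [finrank_ker_modulusPow a₁ one_ne_zero, finrank_ker_modulusPow a₂ hε.ne']
    simp only [Real.rpow_one]
    rcases Nat.eq_zero_or_pos m with rfl | hm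
    · simp only [kerDim_zero, finsum_zero]
    rcases le_or_gt c 1 with hc | hc
    · have hL : ∀ μ : ℂ, ∑ᶠ (_ : ‖μ‖ = c), kerDim (a₁ : Matrix (Fin n) (Fin n) ℝ) μ m = 0 := by
        intro μ
        by_cases hμ : ‖μ‖ = c
        · rw [kerDim_eq_zero h₁ (hμ.trans_le hc), finsum_zero]
        · simp only [hμ, finsum_false]
      have hR : ∀ μ : ℂ, ∑ᶠ (_ : ‖μ‖ ^ ε = c), kerDim (a₂ : Matrix (Fin n) (Fin n) ℝ) μ m = 0 := by
        intro μ
        by_cases hμ : ‖μ‖ ^ ε = c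
        · rw [kerDim_eq_zero h₂, finsum_zero]
          by_contra! hlt
          exact absurd (Real.one_lt_rpow hlt hε) (not_lt.2 (hμ.trans_le hc))
        · simp only [hμ, finsum_false]
      simp only [hL, hR, finsum_zero]
    · have hr : 1 < c ^ ε⁻¹ := Real.one_lt_rpow hc (inv_pos.2 hε)
      have hrε : (c ^ ε⁻¹) ^ ε = c := Real.rpow_inv_rpow (by linarith) hε.ne'
      have h3 := h _ hr m hm
      rw [hrε] at h3
      refine h3.trans (finsum_congr fun μ => ?_)
      have h4 : ‖μ‖ = c ^ ε⁻¹ ↔ ‖μ‖ ^ ε = c := by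
        rw [← Real.rpow_left_inj (norm_nonneg μ) (by positivity) hε.ne', hrε]
      simp only [h4]
  obtain ⟨e, he⟩ := exists_linearEquiv_conj
    (f := Matrix.toLin' (modulusPow (a₁ : Matrix (Fin n) (Fin n) ℝ) 1))
    (g := Matrix.toLin' (modulusPow (a₂ : Matrix (Fin n) (Fin n) ℝ) ε))
    (Matrix.charpoly_monic _).ne_zero (splits_charpoly_modulusPow a₁ one_ne_zero) (hann _)
    (Matrix.charpoly_monic _).ne_zero (splits_charpoly_modulusPow a₂ hε.ne') (hann _) hker
  refine ⟨⟨LinearMap.toMatrix' e.toLinearMap, LinearMap.toMatrix' e.symm.toLinearMap, ?_, ?_⟩, ?_⟩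
  · rw [← LinearMap.toMatrix'_comp]
    simp
  · rw [← LinearMap.toMatrix'_comp]
    simp
  · apply (Matrix.toLin' (R := ℝ) (n := Fin n) (m := Fin n)).injective
    rw [Matrix.toLin'_mul, Matrix.toLin'_mul, Matrix.toLin'_toMatrix']
    exact LinearMap.ext he

theorem modulusPow_conj_intCast {a₁ a₂ S : (Matrix (Fin n) (Fin n) ℝ)ˣ} {ε : ℝ}
    (hS : (S : Matrix (Fin n) (Fin n) ℝ) * modulusPow (a₁ : Matrix (Fin n) (Fin n) ℝ) 1 =
        modulusPow (a₂ : Matrix (Fin n) (Fin n) ℝ) ε * (S : Matrix (Fin n) (Fin n) ℝ)) (k : ℤ) :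
    (S : Matrix (Fin n) (Fin n) ℝ) * modulusPow (a₁ : Matrix (Fin n) (Fin n) ℝ) k =
      modulusPow (a₂ : Matrix (Fin n) (Fin n) ℝ) (k * ε) * (S : Matrix (Fin n) (Fin n) ℝ) := by
  have hneg : (S : Matrix (Fin n) (Fin n) ℝ) * modulusPow (a₁ : Matrix (Fin n) (Fin n) ℝ) (-1) =
      modulusPow (a₂ : Matrix (Fin n) (Fin n) ℝ) (-ε) * (S : Matrix (Fin n) (Fin n) ℝ) := by
    have h1 := congrArg (fun M => modulusPow (a₂ : Matrix (Fin n) (Fin n) ℝ) (-ε) * M *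
      modulusPow (a₁ : Matrix (Fin n) (Fin n) ℝ) (-1)) hS
    simp only [mul_assoc] at h1
    rw [← modulusPow_add, add_neg_cancel, modulusPow_zero, mul_one, ← mul_assoc (modulusPow _ (-ε)),
      ← modulusPow_add, neg_add_cancel, modulusPow_zero, one_mul] at h1
    exact h1.symm
  induction k using Int.induction_on with
  | zero => simp [modulusPow_zero]
  | succ k ih =>
    push_cast at ih ⊢
    rw [modulusPow_add, ← mul_assoc, ih, mul_assoc, hS, ← mul_assoc, ← modulusPow_add, add_mul,
      one_mul]
  | pred k ih =>
    push_cast at ih ⊢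
    rw [sub_eq_add_neg, modulusPow_add, ← mul_assoc, ih, mul_assoc, hneg, ← mul_assoc,
      ← modulusPow_add, add_mul, neg_one_mul]

/-- A similarity between the positive parts at the respective times `1` and `ε` dominates orbits, since
the times `k` and `⌊k / ε⌋ ε` differ by a bounded amount. -/
theorem orbitDominated_of_conj {a₁ a₂ S : (Matrix (Fin n) (Fin n) ℝ)ˣ} {ε : ℝ} (hε : 0 < ε)
    (hS : (S : Matrix (Fin n) (Fin n) ℝ) * modulusPow (a₁ : Matrix (Fin n) (Fin n) ℝ) 1 =
        modulusPow (a₂ : Matrix (Fin n) (Fin n) ℝ) ε * (S : Matrix (Fin n) (Fin n) ℝ)) :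
    OrbitDominated a₁ a₂ (S : Matrix (Fin n) (Fin n) ℝ) ε⁻¹ := by
  obtain ⟨C₁, hC₁, h₁⟩ := exists_norm_zpow_le_modulusPow a₁
  obtain ⟨C₂, hC₂, h₂⟩ := exists_norm_zpow_le_modulusPow a₂
  obtain ⟨C₃, hC₃, h₃⟩ := exists_norm_modulusPow_mulVec_le a₂ ε
  obtain ⟨C₄, hC₄, h₄⟩ := exists_norm_mulVec_le (S : Matrix (Fin n) (Fin n) ℝ)
  refine ⟨C₂ * (C₃ * (C₄ * C₁)), by positivity, fun k x => ?_⟩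
  set j := ⌊(k : ℝ) * ε⁻¹⌋
  have hθ : |(k : ℝ) - j * ε| ≤ ε := by
    have h5 := mul_le_mul_of_nonneg_right (Int.floor_le ((k : ℝ) * ε⁻¹)) hε.le
    have h6 := mul_lt_mul_of_pos_right (Int.lt_floor_add_one ((k : ℝ) * ε⁻¹)) hε
    rw [inv_mul_cancel_right₀ hε.ne'] at h5 h6
    rw [abs_le]
    constructor <;> linarith
  have h8 : modulusPow (a₂ : Matrix (Fin n) (Fin n) ℝ) k * (S : Matrix (Fin n) (Fin n) ℝ) =
      modulusPow (a₂ : Matrix (Fin n) (Fin n) ℝ) (k - j * ε) *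
        ((S : Matrix (Fin n) (Fin n) ℝ) * modulusPow (a₁ : Matrix (Fin n) (Fin n) ℝ) j) := by
    rw [modulusPow_conj_intCast hS, ← mul_assoc, ← modulusPow_add, sub_add_cancel]
  calc _ ≤ C₂ * ‖(modulusPow (a₂ : Matrix (Fin n) (Fin n) ℝ) k).mulVec
          ((S : Matrix (Fin n) (Fin n) ℝ).mulVec x)‖ := (h₂ k _).1
    _ ≤ C₂ * (C₃ * (C₄ * (C₁ * _))) := by
        rw [Matrix.mulVec_mulVec, h8, ← Matrix.mulVec_mulVec, ← Matrix.mulVec_mulVec]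
        gcongr
        refine (h₃ _ hθ _).trans ?_
        gcongr
        refine (h₄ _).trans ?_
        gcongr
        exact (h₁ j x).2
    _ = _ := by ring

theorem orbitDominated_inv_of_conj {a₁ a₂ S : (Matrix (Fin n) (Fin n) ℝ)ˣ} {ε : ℝ}
    (hS : (S : Matrix (Fin n) (Fin n) ℝ) * modulusPow (a₁ : Matrix (Fin n) (Fin n) ℝ) 1 =
        modulusPow (a₂ : Matrix (Fin n) (Fin n) ℝ) ε * (S : Matrix (Fin n) (Fin n) ℝ)) :
    OrbitDominated a₂ a₁ ((S⁻¹ : (Matrix (Fin n) (Fin n) ℝ)ˣ) : Matrix (Fin n) (Fin n) ℝ) ε := by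
  obtain ⟨C₁, hC₁, h₁⟩ := exists_norm_zpow_le_modulusPow a₁
  obtain ⟨C₂, hC₂, h₂⟩ := exists_norm_zpow_le_modulusPow a₂
  obtain ⟨C₃, hC₃, h₃⟩ := exists_norm_modulusPow_mulVec_le a₂ 1
  obtain ⟨C₄, hC₄, h₄⟩ := exists_norm_mulVec_le
    ((S⁻¹ : (Matrix (Fin n) (Fin n) ℝ)ˣ) : Matrix (Fin n) (Fin n) ℝ)
  refine ⟨C₁ * (C₄ * (C₃ * C₂)), by positivity, fun k x => ?_⟩
  set j := ⌊(k : ℝ) * ε⌋ with hj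
  have hθ : |(k : ℝ) * ε - j| ≤ 1 := by
    rw [abs_le]
    constructor
    · linarith [Int.floor_le ((k : ℝ) * ε)]
    · linarith [Int.lt_floor_add_one ((k : ℝ) * ε)]
  have h8 : modulusPow (a₁ : Matrix (Fin n) (Fin n) ℝ) k *
      ((S⁻¹ : (Matrix (Fin n) (Fin n) ℝ)ˣ) : Matrix (Fin n) (Fin n) ℝ) =
      ((S⁻¹ : (Matrix (Fin n) (Fin n) ℝ)ˣ) : Matrix (Fin n) (Fin n) ℝ) *
        (modulusPow (a₂ : Matrix (Fin n) (Fin n) ℝ) (k * ε - j) *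
          modulusPow (a₂ : Matrix (Fin n) (Fin n) ℝ) j) := by
    rw [← modulusPow_add, sub_add_cancel, Units.eq_inv_mul_iff_mul_eq, ← mul_assoc,
      modulusPow_conj_intCast hS, mul_assoc, Units.mul_inv, mul_one]
  calc _ ≤ C₁ * ‖(modulusPow (a₁ : Matrix (Fin n) (Fin n) ℝ) k).mulVec
          (((S⁻¹ : (Matrix (Fin n) (Fin n) ℝ)ˣ) : Matrix (Fin n) (Fin n) ℝ).mulVec x)‖ := (h₁ k _).1
    _ ≤ C₁ * (C₄ * (C₃ * (C₂ * _))) := by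
        rw [Matrix.mulVec_mulVec, h8, ← Matrix.mulVec_mulVec, ← Matrix.mulVec_mulVec]
        gcongr
        refine (h₄ _).trans ?_
        gcongr
        refine (h₃ _ hθ _).trans ?_
        gcongr
        exact (h₂ j x).2
    _ = _ := by ring

end

theorem theorem4p2 (n : ℕ) (A₁ A₂ : Matrix (Fin n) (Fin n) ℝ)
    (hA₁ : IsDilation A₁) (hA₂ : IsDilation A₂)
    (ρ₁ ρ₂ : (Fin n → ℝ) → ℝ)
    (hρ₁ : IsAssociatedQuasiNorm A₁ ρ₁) (hρ₂ : IsAssociatedQuasiNorm A₂ ρ₂) :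
    EquivalentUpToLinear ρ₁ ρ₂ ↔
      ∀ r : ℝ, 1 < r → ∀ m : ℕ, 1 ≤ m →
        sumKerDim A₁ (r ^ (Real.log |A₁.det| / Real.log |A₂.det|)) m = sumKerDim A₂ r m := by
  rcases Nat.eq_zero_or_pos n with rfl | hn
  · -- In dimension zero both sides hold trivially.
    have hsum : ∀ (A : Matrix (Fin 0) (Fin 0) ℝ) (s : ℝ) (m : ℕ), sumKerDim A s m = 0 := by
      intro A s m
      have : ∀ z, kerDim A z m = 0 := fun z => Module.finrank_zero_of_subsingleton
      simp only [sumKerDim, this, finsum_zero]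
    refine ⟨fun _ r _ m _ => by rw [hsum, hsum], fun _ => ⟨1, one_pos, 1, isUnit_one, fun x => ?_⟩⟩
    rw [(hρ₁.eq_zero_iff x).2 (Subsingleton.elim _ _),
      (hρ₂.eq_zero_iff _).2 (Subsingleton.elim _ _)]
    simp
  have hb₁ := hA₁.one_lt_abs_det hn
  have hb₂ := hA₂.one_lt_abs_det hn
  obtain ⟨a₁, rfl⟩ := hA₁.isUnit
  obtain ⟨a₂, rfl⟩ := hA₂.isUnit
  set b₁ := |(a₁ : Matrix (Fin n) (Fin n) ℝ).det|
  set b₂ := |(a₂ : Matrix (Fin n) (Fin n) ℝ).det|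
  have hl₁ : 0 < Real.log b₁ := Real.log_pos hb₁
  have hl₂ : 0 < Real.log b₂ := Real.log_pos hb₂
  set ε := Real.log b₁ / Real.log b₂ with hεdef
  have hε : 0 < ε := div_pos hl₁ hl₂
  have hτ₁ : b₁ ^ ε⁻¹ = b₂ := by
    rw [Real.rpow_def_of_pos (by linarith), hεdef, inv_div, mul_div_cancel₀ _ hl₁.ne',
      Real.exp_log (by linarith)]
  have hτ₂ : b₂ ^ ε = b₁ := by
    rw [Real.rpow_def_of_pos (by linarith), hεdef, mul_div_cancel₀ _ hl₂.ne',
      Real.exp_log (by linarith)]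
  constructor
  · rintro ⟨c, hc, S, ⟨S, rfl⟩, h⟩ r hr m hm
    obtain ⟨d, rfl⟩ := Nat.exists_eq_add_of_le' hm
    have hdom : OrbitDominated a₁ a₂ (S : Matrix (Fin n) (Fin n) ℝ) ε⁻¹ :=
      .of_quasiNorm_le hn hA₁ hA₂ hρ₁ hρ₂ hc.le hτ₁ fun x => (h x).2
    have hdom' : OrbitDominated a₂ a₁
        ((S⁻¹ : (Matrix (Fin n) (Fin n) ℝ)ˣ) : Matrix (Fin n) (Fin n) ℝ) ε := by
      refine .of_quasiNorm_le hn hA₂ hA₁ hρ₂ hρ₁ hc.le hτ₂ fun x => ?_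
      have h1 := (h (((S⁻¹ : (Matrix (Fin n) (Fin n) ℝ)ˣ) : Matrix (Fin n) (Fin n) ℝ).mulVec x)).1
      rwa [Matrix.mulVec_mulVec, Units.mul_inv, Matrix.one_mulVec, one_div,
        inv_mul_le_iff₀ hc] at h1
    refine le_antisymm ?_ (hdom'.sumKerDim_le hr d)
    have h1 := hdom.sumKerDim_le (Real.one_lt_rpow hr hε) d
    rwa [Real.rpow_rpow_inv (by linarith) hε.ne'] at h1
  · intro h
    obtain ⟨S, hS⟩ := exists_conj_modulusPow hA₁ hA₂ hε h
    obtain ⟨c, hc⟩ := (orbitDominated_of_conj hε hS).quasiNorm_le hn hA₁ hA₂ hρ₁ hρ₂ hτ₁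
    obtain ⟨c', hc'⟩ := (orbitDominated_inv_of_conj hS).quasiNorm_le hn hA₂ hA₁ hρ₂ hρ₁ hτ₂
    refine ⟨max 1 (max c c'), by positivity, S, S.isUnit, fun x => ⟨?_, ?_⟩⟩
    · have h1 := hc' ((S : Matrix (Fin n) (Fin n) ℝ).mulVec x)
      rw [Matrix.mulVec_mulVec, Units.inv_mul, Matrix.one_mulVec] at h1
      rw [one_div, inv_mul_le_iff₀ (by positivity)]
      refine h1.trans (mul_le_mul_of_nonneg_right ?_ (hρ₂.nonneg _))
      exact (le_max_right _ _).trans (le_max_right _ _)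
    · refine (hc x).trans (mul_le_mul_of_nonneg_right ?_ (hρ₁.nonneg _))
      exact (le_max_left _ _).trans (le_max_right _ _)
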